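/- Let $n\ge 2$ be an integer, let $k,c_b,\rho_0>0$, and let $\lambda_{1,0}\le\cdots\le\lambda_{n,0}$ be real numbers. Let $J$ be the number of indices $i$ with $\lambda_{i,0}=\lambda_{1,0}$, so that $\lambda_{1,0}=\cdots=\lambda_{J,0}<\lambda_{J+1,0}\le\cdots\le\lambda_{n,0}$. Consider the restricted Euler–Poisson system $$\lambda_i'=-\lambda_i^2+\frac kn(\rho-c_b)\quad(1\le i\le n),\qquad \rho'=-\rho\lambda,\quad \lambda=\sum_{i=1}^n\lambda_i,\qquad \lambda_i(0)=\lambda_{i,0},\quad \rho(0)=\rho_0 .$$ Suppose that the maximal interval of existence of its solution is $[0,t_B)$ with $0<t_B<\infty$. Then $$1\le J\le \frac n2\qquad\text{and}\qquad t_B\ \ge\ \frac1\omega\arctan\Big(\frac{\lambda_{1,0}}{\omega}\Big)+\frac{\pi}{2\omega},\qquad \omega:=\sqrt{kc_b/n}.$$ Moreover, $$\lim_{t\to t_B^-}\lambda_i(t)=-\infty\ \ (1\le i\le J),\qquad \lim_{t\to t_B^-}\lambda_i(t)=+\infty\ \ (J<i\le n),\qquad \lim_{t\to t_B^-}\rho(t)=+\infty,$$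 and there are real numbers $0\le q\le p$ such that $$\lim_{t\to t_B^-}\lambda_1(t)\,e^{\int_0^t(\lambda_1(s)+\lambda_n(s))\,ds}=-p,\qquad \lim_{t\to t_B^-}\lambda_n(t)\,e^{\int_0^t(\lambda_1(s)+\lambda_n(s))\,ds}=q .$$ -/

import Mathlib

open Filter Topology

/-- `(lam, ρ)` solves the restricted Euler–Poisson system with parameters `k, cb` and initial data
`lam0, ρ0` on the interval `[0, T)`; at `t = 0` the derivative is the one-sided one. -/
structure IsREPSolution {n : ℕ} (k cb : ℝ) (lam0 : Fin n → ℝ) (ρ0 T : ℝ)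
    (lam : Fin n → ℝ → ℝ) (ρ : ℝ → ℝ) : Prop where
  lam_init : ∀ i, lam i 0 = lam0 i
  rho_init : ρ 0 = ρ0
  lam_deriv : ∀ i, ∀ t ∈ Set.Ico 0 T,
    HasDerivWithinAt (lam i) (-(lam i t) ^ 2 + k / n * (ρ t - cb)) (Set.Ico 0 T) t
  rho_deriv : ∀ t ∈ Set.Ico 0 T,
    HasDerivWithinAt ρ (-(ρ t) * ∑ i, lam i t) (Set.Ico 0 T) t

/-- `[0, T)` is the maximal interval of existence of the solution `(lam, ρ)`: it solves the system
on `[0, T)` and cannot be extended to a solution on any longer interval `[0, T')`. -/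
structure IsMaximalREPSolution {n : ℕ} (k cb : ℝ) (lam0 : Fin n → ℝ) (ρ0 T : ℝ)
    (lam : Fin n → ℝ → ℝ) (ρ : ℝ → ℝ) : Prop where
  isSolution : IsREPSolution k cb lam0 ρ0 T lam ρ
  maximal : ∀ (T' : ℝ) (lam' : Fin n → ℝ → ℝ) (ρ' : ℝ → ℝ), T < T' →
    IsREPSolution k cb lam0 ρ0 T' lam' ρ' →
    ¬ ((∀ i, Set.EqOn (lam' i) (lam i) (Set.Ico 0 T)) ∧ Set.EqOn ρ' ρ (Set.Ico 0 T))

/-- The number `J` of indices `i` such that the `i`-th initial value coincides with the first. -/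
noncomputable def multiplicityFirst {n : ℕ} (hn : 0 < n) (lam0 : Fin n → ℝ) : ℕ :=
  (Finset.univ.filter fun i => lam0 i = lam0 ⟨0, hn⟩).card

/-!
With `U i = exp ∫ lam i` the Riccati equations become one linear equation
`U'' = (k / n) (ρ - cb) U`, shared by all `U i`, and `ρ = ρ0 / ∏ U i`. Hence Wronskians are
constant, `(lam i - lam j) U i U j = lam0 i - lam0 j`, and reduction of order gives
`U i = U 1 + (lam0 i - lam0 1) v` with a second solution `v = U 1 ∫ (U 1)⁻²`.

*Behaviour of the components.* Since `ρ > 0`, the function `arctan (lam i / ω) + ω t` is monotone,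
so every `lam i` has a limit in `[-∞, ∞]`, and the bound on the blow-up time follows once
`lam 1 → -∞`. That holds because otherwise all quantities would be bounded and the solution could
be continued (`IsMaximalREPSolution.tendsto_atBot`). Where `lam i → -∞`, the function `U i` vanishes
at least linearly with bounded derivative; two components with different initial values cannot both
do so, since their Wronskian would vanish. A component above the lowest one cannot stay finite
either, because then `ρ ≥ c / (T - t)` and it diverges logarithmically
(`IsMaximalREPSolution.tendsto_atTop`). The same divergence excludes that all components coincide.

*Rates.* Put `w = U 1 v`, `P = -w lam 1`, `F = (k / n) ρ w²` and use `x = log (v / U 1) → ∞` as the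
time variable. Then `P` lies eventually in `[0, 1]`, `w → 0`, and, up to errors tending to `0`,
`P' = P (1 - P) - F`, `F' = F ((n - 4) P - (n - J - 2))`, `w' = w (1 - 2 P)`
(`RescaledSystem`). Boundedness of `F` excludes `2 J > n`. If `J ≤ 2`, then `F` is essentially
monotone (or comparable to `w`, for `n = 2`), and if `3 ≤ J < n / 2`, the system is a damped
nonlinear oscillator whose energy controls it; in all cases `F` converges. The equation for `P` is
then an asymptotically autonomous Riccati equation, so `P` converges to some `p`, and `w → 0` forces
`p ≥ 1 / 2`. Since `lam 1 U 1 U n → -(lam0 n - lam0 1) p` and the Wronskian is constant, this gives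
both limits in the last claim, and `0 ≤ 1 - p ≤ p` is the asserted inequality.
-/

open Asymptotics

/-! ### Calculus near `+∞` and near a finite endpoint -/

theorem monotoneOn_of_hasDerivAt_nonneg {D : Set ℝ} (hD : Convex ℝ D) {f f' : ℝ → ℝ}
    (hf : ∀ x ∈ D, HasDerivAt f (f' x) x) (hf' : ∀ x ∈ D, 0 ≤ f' x) : MonotoneOn f D := by
  refine monotoneOn_of_deriv_nonneg hD (fun x hx => (hf x hx).continuousAt.continuousWithinAt)
    (fun x hx => (hf x (interior_subset hx)).differentiableAt.differentiableWithinAt) ?_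
  intro x hx
  rw [(hf x (interior_subset hx)).deriv]
  exact hf' x (interior_subset hx)

theorem exists_tendsto_of_deriv_nonneg {f f' : ℝ → ℝ} {B : ℝ}
    (hf : ∀ᶠ x in atTop, HasDerivAt f (f' x) x) (hf' : ∀ᶠ x in atTop, 0 ≤ f' x)
    (hB : ∀ᶠ x in atTop, f x ≤ B) : ∃ L, Tendsto f atTop (𝓝 L) := by
  obtain ⟨X, hX⟩ := eventually_atTop.1 ((hf.and hf').and hB)
  have hm : MonotoneOn f (Set.Ici X) :=
    monotoneOn_of_hasDerivAt_nonneg (convex_Ici X) (fun x hx => (hX x hx).1.1)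
      (fun x hx => (hX x hx).1.2)
  have hm' : Monotone fun x => f (max x X) := fun x y hxy =>
    hm (Set.mem_Ici.2 (le_max_right x X)) (Set.mem_Ici.2 (le_max_right y X))
      (max_le_max_right X hxy)
  have heq : f =ᶠ[atTop] fun x => f (max x X) := by
    filter_upwards [eventually_ge_atTop X] with x hx
    rw [max_eq_left hx]
  rcases tendsto_atTop_of_monotone hm' with h | ⟨L, hL⟩
  · obtain ⟨x, hx⟩ := (h.eventually_gt_atTop B).exists
    exact absurd (hX _ (le_max_right x X)).2 (not_le.2 hx)
  · exact ⟨L, hL.congr' heq.symm⟩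

theorem exists_tendsto_of_deriv_nonpos {f f' : ℝ → ℝ} {B : ℝ}
    (hf : ∀ᶠ x in atTop, HasDerivAt f (f' x) x) (hf' : ∀ᶠ x in atTop, f' x ≤ 0)
    (hB : ∀ᶠ x in atTop, B ≤ f x) : ∃ L, Tendsto f atTop (𝓝 L) := by
  obtain ⟨L, hL⟩ := exists_tendsto_of_deriv_nonneg (f := fun x => -f x) (f' := fun x => -f' x)
    (B := -B) (hf.mono fun x h => h.neg) (hf'.mono fun x h => by linarith)
    (hB.mono fun x h => by linarith)
  exact ⟨-L, by simpa using hL.neg⟩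

/-- A form of Barbalat's lemma: if `f` converges, then the Lipschitz part of its derivative tends
to `0`, provided the remaining part does. -/
theorem tendsto_zero_of_hasDerivAt_add {f g g' h : ℝ → ℝ} {L : ℝ}
    (hL : Tendsto f atTop (𝓝 L)) (hf : ∀ᶠ x in atTop, HasDerivAt f (g x + h x) x)
    (hh : Tendsto h atTop (𝓝 0)) (hg : ∀ᶠ x in atTop, HasDerivAt g (g' x) x)
    (hg' : g' =O[atTop] (1 : ℝ → ℝ)) : Tendsto g atTop (𝓝 0) := by
  obtain ⟨K, hK'⟩ := hg'.bound
  have hg' : ∀ᶠ x in atTop, |g' x| ≤ K := by simpa using hK'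
  rw [Metric.tendsto_nhds]
  intro ε hε
  set d : ℝ := ε / (4 * (|K| + 1)) with hd
  have hK : 0 < |K| + 1 := by positivity
  have hd0 : 0 < d := by positivity
  have hshift : Tendsto (fun x => f (x + d) - f x) atTop (𝓝 0) := by
    simpa using (hL.comp (tendsto_atTop_add_const_right atTop d tendsto_id)).sub hL
  have e1 : ∀ᶠ x in atTop, |f (x + d) - f x| < d * (ε / 4) := by
    have := (Metric.tendsto_nhds.1 hshift) (d * (ε / 4)) (by positivity)
    simpa [Real.dist_eq] using this
  have e2 : ∀ᶠ x in atTop, |h x| < ε / 4 := by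
    have := (Metric.tendsto_nhds.1 hh) (ε / 4) (by positivity)
    simpa [Real.dist_eq] using this
  obtain ⟨X, hX⟩ := eventually_atTop.1 ((hf.and hg).and (hg'.and e2))
  filter_upwards [e1, eventually_ge_atTop X] with x hx1 hxX
  obtain ⟨c, hc, hcs⟩ := exists_hasDerivAt_eq_slope f (fun x => g x + h x)
    (show x < x + d by linarith)
    (fun y hy => (hX y (hxX.trans hy.1)).1.1.continuousAt.continuousWithinAt)
    (fun y hy => (hX y (hxX.trans hy.1.le)).1.1)
  have hlip : ‖g c - g x‖ ≤ |K| * ‖c - x‖ :=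
    Convex.norm_image_sub_le_of_norm_hasDerivWithin_le (s := Set.Ici X) (f' := g')
      (fun y hy => (hX y hy).1.2.hasDerivWithinAt)
      (fun y hy => (hX y hy).2.1.trans (le_abs_self K)) (convex_Ici X) hxX (hxX.trans hc.1.le)
  have hcx : ‖c - x‖ ≤ d := by
    rw [Real.norm_eq_abs, abs_of_pos (by linarith [hc.1])]; linarith [hc.2]
  have h1 : |g c - g x| ≤ ε / 4 := by
    calc |g c - g x| ≤ |K| * ‖c - x‖ := hlip
      _ ≤ (|K| + 1) * d := by gcongr; linarith
      _ = ε / 4 := by rw [hd]; field_simp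
  have h2 : |g c + h c| ≤ ε / 4 := by
    have : x + d - x = d := by ring
    rw [hcs, this, abs_div, abs_of_pos hd0, div_le_iff₀ hd0]
    linarith
  have h3 := (hX c (hxX.trans hc.1.le)).2.2
  rw [Real.dist_eq, sub_zero]
  have : g x = (g c + h c) - h c - (g c - g x) := by ring
  rw [this]
  rw [abs_le] at h1 h2
  rw [abs_lt] at h3 ⊢
  constructor <;> linarith [h1.1, h1.2, h2.1, h2.2, h3.1, h3.2]

/-- If `Q' > 0` wherever `Q = c`, then `Q` cannot cross the level `c` downwards. -/
theorem eventually_ge_of_hasDerivAt_pos {Q Q' : ℝ → ℝ} {c : ℝ}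
    (hQ : ∀ᶠ x in atTop, HasDerivAt Q (Q' x) x)
    (hc : ∀ᶠ x in atTop, Q x = c → 0 < Q' x) (hfreq : ∃ᶠ x in atTop, c ≤ Q x) :
    ∀ᶠ x in atTop, c ≤ Q x := by
  obtain ⟨X, hX⟩ := eventually_atTop.1 (hQ.and hc)
  obtain ⟨x0, hx0, hx0X⟩ := (hfreq.and_eventually (eventually_ge_atTop X)).exists
  filter_upwards [eventually_ge_atTop x0] with x hx
  refine image_le_of_deriv_right_lt_deriv_boundary' (f := fun _ => c) (f' := fun _ => 0)
    (a := x0) (b := x) continuousOn_const (fun y _ => hasDerivWithinAt_const _ _ _) hx0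
    (B := Q) (B' := Q')
    (fun y hy => (hX y (hx0X.trans hy.1)).1.continuousAt.continuousWithinAt)
    (fun y hy => (hX y (hx0X.trans hy.1)).1.hasDerivWithinAt)
    (fun y hy h => (hX y (hx0X.trans hy.1)).2 h.symm) (Set.right_mem_Icc.2 hx)

/-- A bounded solution of the asymptotically autonomous Riccati equation `Q' = μ - Q² + o(1)`
converges to a root of `μ - Q²`: a level `c` with `c² ≠ μ` can only be crossed in one direction. -/
theorem exists_tendsto_of_riccati {Q h : ℝ → ℝ} {μ B : ℝ}
    (hQ : ∀ᶠ x in atTop, HasDerivAt Q (μ - Q x ^ 2 + h x) x) (hh : Tendsto h atTop (𝓝 0))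
    (hB : ∀ᶠ x in atTop, |Q x| ≤ B) : ∃ L, L ^ 2 = μ ∧ Tendsto Q atTop (𝓝 L) := by
  have key : ∃ L, Tendsto Q atTop (𝓝 L) := by
    refine tendsto_of_no_upcrossings (s := Set.univ) dense_univ ?_
      ⟨B, by simpa using hB.mono fun x hx => (abs_le.1 hx).2⟩
      ⟨-B, by simpa using hB.mono fun x hx => (abs_le.1 hx).1⟩
    rintro a - b - hab ⟨ha, hb⟩
    -- among three levels between `a` and `b` one is not a root of `μ - c²`
    obtain ⟨c, hac, hcb, hc⟩ : ∃ c, a < c ∧ c < b ∧ μ - c ^ 2 ≠ 0 := by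
      by_contra! hcon
      have h1 := hcon (a + (b - a) / 4) (by linarith) (by linarith)
      have h2 := hcon (a + (b - a) / 2) (by linarith) (by linarith)
      have h3 := hcon (a + 3 * (b - a) / 4) (by linarith) (by linarith)
      nlinarith [mul_pos (sub_pos.2 hab) (sub_pos.2 hab)]
    rcases lt_or_gt_of_ne hc with hneg | hpos
    · have hev : ∀ᶠ x in atTop, h x < -(μ - c ^ 2) := hh.eventually_lt_const (by linarith)
      have := eventually_ge_of_hasDerivAt_pos (Q := fun x => -Q x) (c := -c)
        (hQ.mono fun x hx => hx.neg)
        (hev.mono fun x hx hxc => by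
          have : Q x = c := by linarith
          rw [this]; linarith)
        (ha.mono fun x hx => by linarith)
      obtain ⟨x, hx1, hx2⟩ := (hb.and_eventually this).exists
      linarith
    · have hev : ∀ᶠ x in atTop, -(μ - c ^ 2) < h x := hh.eventually_const_lt (by linarith)
      have := eventually_ge_of_hasDerivAt_pos (c := c) hQ
        (hev.mono fun x hx hxc => by rw [hxc]; linarith)
        (hb.mono fun x hx => by linarith)
      obtain ⟨x, hx1, hx2⟩ := (ha.and_eventually this).exists
      linarith
  obtain ⟨L, hL⟩ := key
  refine ⟨L, ?_, hL⟩
  have h0 : Tendsto (fun _ : ℝ => μ - L ^ 2) atTop (𝓝 0) := by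
    refine tendsto_zero_of_hasDerivAt_add (h := fun x => L ^ 2 - Q x ^ 2 + h x)
      (g' := fun _ => 0) hL (hQ.mono fun x hx => ?_) ?_
      (Eventually.of_forall fun x => hasDerivAt_const x _) (isBigO_zero _ _)
    · convert hx using 1; ring
    · have := ((tendsto_const_nhds (x := L ^ 2)).sub (hL.pow 2)).add hh
      rwa [sub_self, add_zero] at this
  have := tendsto_nhds_unique h0 tendsto_const_nhds
  linarith

/-- A positive function whose logarithmic derivative is bounded below by a positive constant
grows at least exponentially. -/
theorem tendsto_atTop_of_log_deriv {f r : ℝ → ℝ} {c : ℝ} (hc : 0 < c)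
    (hf : ∀ᶠ x in atTop, HasDerivAt f (f x * r x) x) (hr : ∀ᶠ x in atTop, c ≤ r x)
    (hpos : ∀ᶠ x in atTop, 0 < f x) : Tendsto f atTop atTop := by
  obtain ⟨X, hX⟩ := eventually_atTop.1 ((hf.and hr).and hpos)
  have hm : MonotoneOn (fun x => f x * Real.exp (-(c * x))) (Set.Ici X) := by
    refine monotoneOn_of_hasDerivAt_nonneg (convex_Ici X)
      (f' := fun x => f x * (r x - c) * Real.exp (-(c * x))) (fun x hx => ?_) (fun x hx => ?_)
    · refine ((hX x hx).1.1.mul (((hasDerivAt_id x).const_mul c).neg.exp)).congr_deriv ?_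
      simp only [Pi.neg_apply, id]
      ring
    · have := hX x hx
      exact mul_nonneg (mul_nonneg this.2.le (by linarith [this.1.2])) (Real.exp_pos _).le
  have hfX := (hX X le_rfl).2
  refine tendsto_atTop_mono' (f₁ := fun x => f X * Real.exp (-(c * X)) * Real.exp (c * x)) _ ?_ ?_
  · filter_upwards [eventually_ge_atTop X] with x hx
    have := hm Set.self_mem_Ici hx hx
    calc _ ≤ f x * Real.exp (-(c * x)) * Real.exp (c * x) := by gcongr
      _ = f x := by rw [mul_assoc, ← Real.exp_add]; simp
  · exact (Real.tendsto_exp_atTop.comp (tendsto_id.const_mul_atTop hc)).const_mul_atTop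
      (by positivity)

/-- Change of the time variable: if `φ' = 1 / w > 0` on `(0, T)` and `φ → ∞` at `T`, then `φ` has an
inverse `τ` near `T`, with `τ' = w ∘ τ`. -/
theorem exists_inverse_clock {T : ℝ} (hT : 0 < T) {φ w : ℝ → ℝ}
    (hφ : ∀ t ∈ Set.Ioo 0 T, HasDerivAt φ (w t)⁻¹ t) (hw : ∀ t ∈ Set.Ioo 0 T, 0 < w t)
    (hlim : Tendsto φ (𝓝[<] T) atTop) :
    ∃ τ : ℝ → ℝ, (∀ᶠ x in atTop, HasDerivAt τ (w (τ x)) x) ∧ (∀ᶠ x in atTop, φ (τ x) = x) ∧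
      Tendsto τ atTop (𝓝[<] T) ∧ ∀ᶠ t in 𝓝[<] T, τ (φ t) = t := by
  have hmono : StrictMonoOn φ (Set.Ioo 0 T) := by
    refine strictMonoOn_of_deriv_pos (convex_Ioo 0 T)
      (fun x hx => (hφ x hx).continuousAt.continuousWithinAt) fun x hx => ?_
    rw [interior_Ioo] at hx
    rw [(hφ x hx).deriv]
    exact inv_pos.2 (hw x hx)
  have hcont : ContinuousOn φ (Set.Ioo 0 T) :=
    fun x hx => (hφ x hx).continuousAt.continuousWithinAt
  have hmid : T / 2 ∈ Set.Ioo 0 T := ⟨by linarith, by linarith⟩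
  have hnear : ∀ᶠ t in 𝓝[<] T, t ∈ Set.Ioo (T / 2) T :=
    Ioo_mem_nhdsLT (by linarith)
  have hsurj : ∀ x, φ (T / 2) < x → ∃ t ∈ Set.Ioo (T / 2) T, φ t = x := by
    intro x hx
    obtain ⟨t1, ht1, ht1'⟩ := ((hlim.eventually_gt_atTop x).and hnear).exists
    obtain ⟨t, ht, htx⟩ := intermediate_value_Ioo ht1'.1.le
      (hcont.mono fun y hy => ⟨by linarith [hy.1], by linarith [hy.2, ht1'.2]⟩)
      (show x ∈ Set.Ioo (φ (T / 2)) (φ t1) from ⟨hx, ht1⟩)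
    exact ⟨t, ⟨ht.1, ht.2.trans ht1'.2⟩, htx⟩
  choose! τ hτm hτ using hsurj
  have hsub : Set.Ioo (T / 2) T ⊆ Set.Ioo 0 T := Set.Ioo_subset_Ioo_left (by linarith)
  have hleft : ∀ t ∈ Set.Ioo (T / 2) T, τ (φ t) = t := by
    intro t ht
    have h1 : φ (T / 2) < φ t := hmono hmid (hsub ht) ht.1
    exact hmono.injOn (hsub (hτm _ h1)) (hsub ht) (hτ _ h1)
  have hτmono : StrictMonoOn τ (Set.Ioi (φ (T / 2))) := by
    intro x hx y hy hxy
    by_contra! hcon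
    have := hmono.monotoneOn (hsub (hτm y hy)) (hsub (hτm x hx)) hcon
    rw [hτ x hx, hτ y hy] at this
    linarith
  have himage : τ '' Set.Ioi (φ (T / 2)) = Set.Ioo (T / 2) T := by
    ext t
    constructor
    · rintro ⟨x, hx, rfl⟩; exact hτm x hx
    · intro ht; exact ⟨φ t, hmono hmid (hsub ht) ht.1, hleft t ht⟩
  refine ⟨τ, ?_, ?_, ?_, ?_⟩
  · filter_upwards [eventually_gt_atTop (φ (T / 2))] with x hx
    have hc : ContinuousAt τ x := hτmono.continuousAt_of_image_mem_nhds (Ioi_mem_nhds hx)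
      (by rw [himage]; exact Ioo_mem_nhds (hτm x hx).1 (hτm x hx).2)
    have hw' := hw _ (hsub (hτm x hx))
    have := HasDerivAt.of_local_left_inverse hc (hφ _ (hsub (hτm x hx))) (inv_pos.2 hw').ne'
      ((eventually_gt_nhds hx).mono fun y hy => hτ y hy)
    simpa using this
  · filter_upwards [eventually_gt_atTop (φ (T / 2))] with x hx using hτ x hx
  · refine tendsto_nhdsWithin_iff.2 ⟨tendsto_order.2 ⟨fun a ha => ?_, fun a ha => ?_⟩, ?_⟩
    · have hm : max a (T / 2) < T := max_lt ha (by linarith)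
      obtain ⟨t, ht1, ht2⟩ := exists_between hm
      have htm : t ∈ Set.Ioo (T / 2) T := ⟨(le_max_right _ _).trans_lt ht1, ht2⟩
      filter_upwards [eventually_gt_atTop (φ t)] with x hx
      have hx0 : φ (T / 2) < φ t := hmono hmid (hsub htm) htm.1
      have := hτmono hx0 (hx0.trans hx) hx
      rw [hleft t htm] at this
      exact (le_max_left _ _).trans_lt (ht1.trans this)
    · filter_upwards [eventually_gt_atTop (φ (T / 2))] with x hx using (hτm x hx).2.trans ha
    · filter_upwards [eventually_gt_atTop (φ (T / 2))] with x hx using (hτm x hx).2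
  · exact hnear.mono hleft

/-! ### The rescaled system -/

theorem Asymptotics.IsBigO.mul_one_one {f g : ℝ → ℝ} (hf : f =O[atTop] (1 : ℝ → ℝ))
    (hg : g =O[atTop] (1 : ℝ → ℝ)) : (fun x => f x * g x) =O[atTop] (1 : ℝ → ℝ) := by
  exact (hf.mul hg).congr_right fun x => by simp

theorem Asymptotics.IsBigO.mul_tendsto_zero {f g : ℝ → ℝ} (hf : f =O[atTop] (1 : ℝ → ℝ))
    (hg : Tendsto g atTop (𝓝 0)) : Tendsto (fun x => f x * g x) atTop (𝓝 0) := by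
  have h1 : g =o[atTop] (1 : ℝ → ℝ) := (isLittleO_one_iff ℝ).2 hg
  have := hf.mul_isLittleO h1
  exact (isLittleO_one_iff ℝ).1 (by simpa using this)

/-- The system satisfied near blow-up by `P = -w lam 1`, `F = (k / n) ρ w²` and `w = U 1 v` as
functions of `x = log (v / U 1)`, where `J` of the `n` components coincide with the lowest one and
`b = k cb / n`. The original time is `τ`, which stays bounded, so that `w = τ'` is integrable; `η`
is the exponentially small error made by replacing `U i` with a multiple of `v` for `i > J`. All
conditions are imposed for large `x` only. -/
structure RescaledSystem (n J : ℕ) (b C : ℝ) (P F w τ η : ℝ → ℝ) : Prop where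
  P_mem : ∀ᶠ x in atTop, 0 ≤ P x ∧ P x ≤ 1
  F_pos : ∀ᶠ x in atTop, 0 < F x
  w_pos : ∀ᶠ x in atTop, 0 < w x
  η_mem : ∀ᶠ x in atTop, 0 ≤ η x ∧ η x ≤ C * Real.exp (-x)
  P_deriv : ∀ᶠ x in atTop, HasDerivAt P (P x * (1 - P x) - F x + b * w x ^ 2) x
  F_deriv : ∀ᶠ x in atTop, HasDerivAt F (F x * ((n - 4) * P x - (n - J - 2) + η x)) x
  w_deriv : ∀ᶠ x in atTop, HasDerivAt w (w x * (1 - 2 * P x)) x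
  τ_deriv : ∀ᶠ x in atTop, HasDerivAt τ (w x) x
  τ_lim : ∃ T, Tendsto τ atTop (𝓝 T)
  w_lim : Tendsto w atTop (𝓝 0)

namespace RescaledSystem

variable {n J : ℕ} {b C : ℝ} {P F w τ η : ℝ → ℝ}

theorem tendsto_forcing (H : RescaledSystem n J b C P F w τ η) :
    Tendsto (fun x => b * w x ^ 2) atTop (𝓝 0) := by
  simpa using (H.w_lim.pow 2).const_mul b

theorem tendsto_η (H : RescaledSystem n J b C P F w τ η) : Tendsto η atTop (𝓝 0) := by
  refine tendsto_of_tendsto_of_tendsto_of_le_of_le' tendsto_const_nhds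
    (h := fun x => C * Real.exp (-x)) ?_ (H.η_mem.mono fun x h => h.1)
    (H.η_mem.mono fun x h => h.2)
  simpa using (Real.tendsto_exp_neg_atTop_nhds_zero).const_mul C

/-- `F` cannot be large: it changes at most exponentially, while `P' ≤ 2 - F` and `P` stays in
`[0, 1]`. -/
theorem exists_F_le (H : RescaledSystem n J b C P F w τ η) : ∃ B, ∀ᶠ x in atTop, F x ≤ B := by
  have e1 : ∀ᶠ x in atTop, b * w x ^ 2 ≤ 1 :=
    H.tendsto_forcing.eventually_le_const (by norm_num)
  obtain ⟨X, hX⟩ := eventually_atTop.1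
    ((H.P_mem.and (H.F_pos.and H.η_mem)).and (H.P_deriv.and (H.F_deriv.and e1)))
  set K : ℝ := n + 4 with hK
  have hm : MonotoneOn (fun x => F x * Real.exp (K * x)) (Set.Ici X) := by
    refine monotoneOn_of_hasDerivAt_nonneg (convex_Ici X)
      (f' := fun x => F x * ((n - 4) * P x - (n - J - 2) + η x + K) * Real.exp (K * x))
      (fun x hx => ?_) (fun x hx => ?_)
    · refine ((hX x hx).2.2.1.mul (((hasDerivAt_id x).const_mul K).exp)).congr_deriv ?_
      simp only [id]
      ring
    · obtain ⟨⟨hP, hF, hη⟩, -⟩ := hX x hx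
      refine mul_nonneg (mul_nonneg hF.le ?_) (Real.exp_pos _).le
      have hn : (0 : ℝ) ≤ n := Nat.cast_nonneg n
      have hJ : (0 : ℝ) ≤ J := Nat.cast_nonneg J
      nlinarith [mul_nonneg hn hP.1]
  refine ⟨3 * Real.exp K, ?_⟩
  filter_upwards [eventually_ge_atTop X] with x hx
  have hlow : ∀ y ∈ Set.Icc x (x + 1), F x * Real.exp (-K) ≤ F y := by
    intro y hy
    have hyX : X ≤ y := hx.trans hy.1
    have h1 := hm (Set.mem_Ici.2 hx) (Set.mem_Ici.2 hyX) hy.1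
    have hFy := (hX y hyX).1.2.1
    have hKp : 0 < K := by positivity
    have h2 : F x ≤ F y * Real.exp (K * (y - x)) := by
      have : Real.exp (K * (y - x)) = Real.exp (K * y) * Real.exp (-(K * x)) := by
        rw [← Real.exp_add]; ring_nf
      rw [this, ← mul_assoc]
      calc F x = F x * Real.exp (K * x) * Real.exp (-(K * x)) := by
            rw [mul_assoc, ← Real.exp_add]; simp
        _ ≤ _ := by gcongr
    have h3 : Real.exp (K * (y - x)) ≤ Real.exp K := by
      apply Real.exp_le_exp.2; nlinarith [hy.2]
    rw [Real.exp_neg, ← div_eq_mul_inv, div_le_iff₀ (Real.exp_pos K)]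
    exact h2.trans (by gcongr)
  have hanti : MonotoneOn (fun y => (2 - F x * Real.exp (-K)) * y - P y) (Set.Icc x (x + 1)) := by
    refine monotoneOn_of_hasDerivAt_nonneg (convex_Icc _ _)
      (f' := fun y => (2 - F x * Real.exp (-K)) * 1 - (P y * (1 - P y) - F y + b * w y ^ 2))
      (fun y hy => ((hasDerivAt_id y).const_mul _).sub (hX y (hx.trans hy.1)).2.1)
      (fun y hy => ?_)
    obtain ⟨⟨hP, -⟩, -, -, hb⟩ := hX y (hx.trans hy.1)
    have := hlow y hy
    nlinarith [sq_nonneg (P y)]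
  have h := hanti (Set.left_mem_Icc.2 (by linarith)) (Set.right_mem_Icc.2 (by linarith))
    (by linarith : x ≤ x + 1)
  have hP0 := (hX x hx).1.1
  have hP1 := (hX (x + 1) (by linarith)).1.1
  have h3 : F x * Real.exp (-K) ≤ 3 := by
    simp only at h
    linarith
  rwa [Real.exp_neg, ← div_eq_mul_inv, div_le_iff₀ (Real.exp_pos K)] at h3

theorem hasDerivAt_exp_exp (C x : ℝ) : HasDerivAt (fun x => Real.exp (C * Real.exp (-x)))
    (Real.exp (C * Real.exp (-x)) * -(C * Real.exp (-x))) x := by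
  refine (((hasDerivAt_id x).neg.exp).const_mul C).exp.congr_deriv ?_
  simp only [Pi.neg_apply, id]
  ring

/-- If the leading part of `(log F)'` is nonpositive, then `F e ^ (C e ^ (-x))` is monotone. -/
theorem exists_tendsto_F_of_nonpos (H : RescaledSystem n J b C P F w τ η)
    (hθ : ∀ᶠ x in atTop, (n - 4) * P x - (n - J - 2) ≤ 0) : ∃ L, Tendsto F atTop (𝓝 L) := by
  obtain ⟨L, hL⟩ := exists_tendsto_of_deriv_nonpos (B := 0)
    (f := fun x => F x * Real.exp (C * Real.exp (-x)))
    (f' := fun x => F x * ((n - 4) * P x - (n - J - 2) + η x - C * Real.exp (-x)) *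
      Real.exp (C * Real.exp (-x)))
    (H.F_deriv.mono fun x hx => by
      refine (hx.mul (hasDerivAt_exp_exp C x)).congr_deriv ?_
      ring)
    (by
      filter_upwards [H.F_pos, H.η_mem, hθ] with x h1 h2 h3
      exact mul_nonpos_of_nonpos_of_nonneg
        (mul_nonpos_of_nonneg_of_nonpos h1.le (by linarith [h2.2])) (Real.exp_pos _).le)
    (H.F_pos.mono fun x h => by positivity)
  refine ⟨L, ?_⟩
  have h1 : Tendsto (fun x => Real.exp (-(C * Real.exp (-x)))) atTop (𝓝 1) := by
    have := ((Real.tendsto_exp_neg_atTop_nhds_zero).const_mul C).neg.rexp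
    simpa using this
  have := hL.mul h1
  rw [mul_one] at this
  refine this.congr fun x => ?_
  rw [mul_assoc, ← Real.exp_add]; simp

theorem exists_tendsto_F_of_nonneg (H : RescaledSystem n J b C P F w τ η)
    (hθ : ∀ᶠ x in atTop, 0 ≤ (n - 4) * P x - (n - J - 2)) :
    ∃ L, 0 < L ∧ Tendsto F atTop (𝓝 L) := by
  obtain ⟨B, hB⟩ := H.exists_F_le
  have hd : ∀ᶠ x in atTop, 0 ≤ F x * ((n - 4) * P x - (n - J - 2) + η x) := by
    filter_upwards [H.F_pos, H.η_mem, hθ] with x h1 h2 h3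
    exact mul_nonneg h1.le (by linarith [h2.1])
  obtain ⟨L, hL⟩ := exists_tendsto_of_deriv_nonneg H.F_deriv hd hB
  refine ⟨L, ?_, hL⟩
  obtain ⟨X, hX⟩ := eventually_atTop.1 ((H.F_deriv.and hd).and H.F_pos)
  have hm : MonotoneOn F (Set.Ici X) :=
    monotoneOn_of_hasDerivAt_nonneg (convex_Ici X) (fun x hx => (hX x hx).1.1)
      (fun x hx => (hX x hx).1.2)
  refine (hX X le_rfl).2.trans_le (ge_of_tendsto hL ?_)
  filter_upwards [eventually_ge_atTop X] with x hx using hm Set.self_mem_Ici hx hx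

/-- The quantity `F w ^ ((n - 4) / 2) e ^ ((n / 2 - J) x)` is conserved up to the integrable
logarithmic rate `η`. -/
theorem hasDerivAt_log (H : RescaledSystem n J b C P F w τ η) : ∀ᶠ x in atTop,
    HasDerivAt (fun x => Real.log (F x) + (n - 4) / 2 * Real.log (w x) + (n / 2 - J) * x)
      (η x) x := by
  filter_upwards [H.F_pos, H.w_pos, H.F_deriv, H.w_deriv] with x h1 h2 h3 h4
  refine (((h3.log h1.ne').add ((h4.log h2.ne').const_mul (((n : ℝ) - 4) / 2))).add
    ((hasDerivAt_id x).const_mul ((n : ℝ) / 2 - J))).congr_deriv ?_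
  field_simp
  ring

/-- Since `w → 0`, the almost conserved quantity forces `F → ∞` if `n ≤ 2 J`. -/
theorem two_mul_lt_of_five_le (H : RescaledSystem n J b C P F w τ η)
    (hn : 5 ≤ n) : 2 * J < n := by
  by_contra! hcon
  obtain ⟨B, hB⟩ := H.exists_F_le
  obtain ⟨X, hX⟩ := eventually_atTop.1 (H.hasDerivAt_log.and H.η_mem)
  have hm := monotoneOn_of_hasDerivAt_nonneg (convex_Ici X) (fun x hx => (hX x hx).1)
    (fun x hx => (hX x hx).2.1)
  set c := Real.log (F X) + (n - 4) / 2 * Real.log (w X) + (n / 2 - J) * X with hc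
  have hw : Tendsto (fun x => Real.log (w x)) atTop atBot :=
    Real.tendsto_log_nhdsGT_zero.comp (tendsto_nhdsWithin_iff.2 ⟨H.w_lim, H.w_pos⟩)
  have hn' : (5 : ℝ) ≤ n := by exact_mod_cast hn
  have hcon' : (n : ℝ) ≤ 2 * J := by exact_mod_cast hcon
  have h0 : (0 : ℝ) < ((n : ℝ) - 4) / 2 := by linarith
  have hw2 : Tendsto (fun x => (n - 4) / 2 * Real.log (w x)) atTop atBot :=
    hw.const_mul_atBot h0
  obtain ⟨x, hx, hxX, hFB, hF0, hx0⟩ := ((hw2.eventually_lt_atBot (c - Real.log B)).and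
    ((eventually_ge_atTop X).and (hB.and (H.F_pos.and (eventually_ge_atTop 0))))).exists
  have h1 := hm Set.self_mem_Ici (Set.mem_Ici.2 hxX) hxX
  have h2 := Real.log_le_log hF0 hFB
  simp only at h1
  nlinarith

/-- For `n = 2`, `J = 1` the almost conserved quantity is `F / w`. -/
theorem tendsto_F_of_eq_two (H : RescaledSystem 2 1 b C P F w τ η) :
    Tendsto F atTop (𝓝 0) := by
  have hd : ∀ᶠ x in atTop, HasDerivAt (fun x => Real.log (F x) - Real.log (w x) +
      C * Real.exp (-x)) (η x - C * Real.exp (-x)) x := by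
    filter_upwards [H.hasDerivAt_log] with x hx
    have := hx.add (((hasDerivAt_id x).neg.exp).const_mul C)
    refine (this.congr_of_eventuallyEq (Eventually.of_forall fun y => ?_)).congr_deriv ?_
    · simp; ring
    · simp; ring
  obtain ⟨X, hX⟩ := eventually_atTop.1 (hd.and H.η_mem)
  have hm := monotoneOn_of_hasDerivAt_nonneg (convex_Ici X) (fun x hx => (hX x hx).1.neg)
    (fun x hx => by linarith [(hX x hx).2.2])
  set c := Real.log (F X) - Real.log (w X) + C * Real.exp (-X) with hc
  refine tendsto_of_tendsto_of_tendsto_of_le_of_le' tendsto_const_nhds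
    (h := fun x => Real.exp c * w x) (by simpa using H.w_lim.const_mul (Real.exp c))
    (H.F_pos.mono fun x h => h.le) ?_
  filter_upwards [eventually_ge_atTop X, H.F_pos, H.w_pos, H.η_mem] with x hx hF hw hη
  have h1 := hm Set.self_mem_Ici (Set.mem_Ici.2 hx) hx
  simp only [Pi.neg_apply] at h1
  rw [← Real.exp_log hF, ← Real.exp_log hw, ← Real.exp_add, Real.exp_le_exp]
  linarith [hη.1, hη.2]

/-- Once `F` converges, `P` satisfies an asymptotically autonomous Riccati equation. -/
theorem exists_tendsto_P (H : RescaledSystem n J b C P F w τ η) {L : ℝ}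
    (hL : Tendsto F atTop (𝓝 L)) :
    ∃ p, 1 / 2 ≤ p ∧ p ≤ 1 ∧ p * (1 - p) = L ∧ Tendsto P atTop (𝓝 p) := by
  obtain ⟨q, hq, hQ⟩ := exists_tendsto_of_riccati (Q := fun x => P x - 1 / 2) (μ := 1 / 4 - L)
    (h := fun x => (L - F x) + b * w x ^ 2) (B := 1 / 2)
    (H.P_deriv.mono fun x hx => by
      refine (hx.sub_const (1 / 2)).congr_deriv ?_
      ring)
    (by simpa using ((tendsto_const_nhds (x := L)).sub hL).add H.tendsto_forcing)
    (H.P_mem.mono fun x hx => by rw [abs_le]; constructor <;> linarith [hx.1, hx.2])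
  have hP : Tendsto P atTop (𝓝 (q + 1 / 2)) := (hQ.add_const (1 / 2)).congr fun x => by ring
  refine ⟨q + 1 / 2, ?_, le_of_tendsto hP (H.P_mem.mono fun x h => h.2), by nlinarith, hP⟩
  -- if the limit of `P` were less than `1 / 2`, then `w` would grow
  by_contra! hcon
  have h1 : Tendsto w atTop atTop := by
    refine tendsto_atTop_of_log_deriv (c := -q) (by linarith) H.w_deriv ?_ H.w_pos
    filter_upwards [hP.eventually_lt_const (show q + 1 / 2 < q / 2 + 1 / 2 by linarith)] with x hx
    linarith
  exact not_tendsto_nhds_of_tendsto_atTop h1 0 H.w_lim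

end RescaledSystem

namespace RescaledSystem

variable {n J : ℕ} {b C : ℝ} {P F w τ η : ℝ → ℝ}

/-- For `3 ≤ J < n / 2` the rescaled system is a perturbation of a damped oscillator: with
`κ = n - 4`, `γ = (n / 2 - J) / κ`, `ζ = F ^ (1 / κ)` and `R = P - 1 / 2 - γ = ζ' / ζ` (up to
integrable errors), the energy `ζ² (R² - m) / 2 + ζ ^ (κ + 2) / (κ + 2)` is dissipated at the rate
`2 γ ζ² R²`. Barbalat's lemma, applied to the energy and then to `ζ R`, shows that `ζ` converges. -/
theorem exists_tendsto_F_of_three_le (H : RescaledSystem n J b C P F w τ η) (hJ : 3 ≤ J)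
    (hn : 2 * J < n) : ∃ L, Tendsto F atTop (𝓝 L) := by
  obtain ⟨k, rfl⟩ : ∃ k : ℕ, n = k + 4 := ⟨n - 4, by omega⟩
  have hk : (3 : ℝ) ≤ k := by exact_mod_cast (by omega : 3 ≤ k)
  have hk0 : (0 : ℝ) < k := by linarith
  have hJ' : (3 : ℝ) ≤ J := by exact_mod_cast hJ
  have hn' : 2 * (J : ℝ) < k + 4 := by exact_mod_cast hn
  set γ : ℝ := (((k : ℝ) + 4) / 2 - J) / k with hγ
  have hγk : γ * k = ((k : ℝ) + 4) / 2 - J := by rw [hγ]; field_simp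
  have hγ0 : 0 < γ := by rw [hγ]; apply div_pos <;> linarith
  have hγ1 : γ < 1 / 2 := by rw [hγ, div_lt_iff₀ hk0]; linarith
  set m : ℝ := 1 / 4 - γ ^ 2 with hm
  have hm0 : 0 < m := by nlinarith
  have hm1 : m ≤ 1 / 4 := by nlinarith [sq_nonneg γ]
  obtain ⟨B, hB⟩ := H.exists_F_le
  obtain ⟨T, hT⟩ := H.τ_lim
  set ζ : ℝ → ℝ := fun x => Real.exp (Real.log (F x) / k) with hζ
  set R : ℝ → ℝ := fun x => P x - 1 / 2 - γ with hR
  set e : ℝ → ℝ := fun x => η x / k with he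
  set δ : ℝ → ℝ := fun x => b * w x ^ 2 with hδ
  have hζ0 : ∀ x, 0 < ζ x := fun x => Real.exp_pos _
  have hζF : ∀ᶠ x in atTop, F x = ζ x ^ k := by
    filter_upwards [H.F_pos] with x hx
    rw [hζ, ← Real.exp_nat_mul, mul_div_cancel₀ _ hk0.ne', Real.exp_log hx]
  have hFd : ∀ᶠ x in atTop, HasDerivAt F (F x * (k * (R x + e x))) x := by
    filter_upwards [H.F_deriv] with x hx
    refine hx.congr_deriv ?_
    have : k * (R x + e x) = k * P x - k / 2 - γ * k + η x := by
      simp only [hR, he]; field_simp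
    rw [this, hγk]
    push_cast
    ring
  have hζd : ∀ᶠ x in atTop, HasDerivAt ζ (ζ x * (R x + e x)) x := by
    filter_upwards [hFd, H.F_pos] with x hx h0
    refine (((hx.log h0.ne').div_const (k : ℝ)).exp).congr_deriv ?_
    simp only [hζ]
    field_simp
  have hRd : ∀ᶠ x in atTop, HasDerivAt R (m - 2 * γ * R x - R x ^ 2 - F x + δ x) x := by
    filter_upwards [H.P_deriv] with x hx
    refine ((hx.sub_const (1 / 2)).sub_const γ).congr_deriv ?_
    simp only [hR, hδ, hm]; ring
  have he0 : Tendsto e atTop (𝓝 0) := by simpa using H.tendsto_η.div_const (k : ℝ)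
  have hδ0 : Tendsto δ atTop (𝓝 0) := H.tendsto_forcing
  have hR1 : ∀ᶠ x in atTop, |R x| ≤ 1 := by
    filter_upwards [H.P_mem] with x hx
    simp only [hR]
    rw [abs_le]; constructor <;> linarith [hx.1, hx.2]
  set Z : ℝ := Real.exp (Real.log B / k) with hZ
  have hζZ : ∀ᶠ x in atTop, ζ x ≤ Z := by
    filter_upwards [hB, H.F_pos] with x h1 h2
    exact Real.exp_le_exp.2 (by gcongr)
  have hB0 : 0 < B := by
    obtain ⟨x, h1, h2⟩ := (hB.and H.F_pos).exists
    linarith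
  -- boundedness of all quantities
  have oR : R =O[atTop] (1 : ℝ → ℝ) := IsBigO.of_bound 1 (by simpa using hR1)
  have oζ : ζ =O[atTop] (1 : ℝ → ℝ) := IsBigO.of_bound Z (by
    filter_upwards [hζZ] with x hx
    simpa [abs_of_pos (hζ0 x)] using hx)
  have oF : F =O[atTop] (1 : ℝ → ℝ) := IsBigO.of_bound B (by
    filter_upwards [hB, H.F_pos] with x hx h0
    simpa [abs_of_pos h0] using hx)
  have oe : e =O[atTop] (1 : ℝ → ℝ) := he0.isBigO_one ℝ
  have oδ : δ =O[atTop] (1 : ℝ → ℝ) := hδ0.isBigO_one ℝ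
  have oc : ∀ c : ℝ, (fun _ : ℝ => c) =O[atTop] (1 : ℝ → ℝ) := fun c =>
    isBigO_const_const c one_ne_zero atTop
  have oRe : (fun x => R x + e x) =O[atTop] (1 : ℝ → ℝ) := oR.add oe
  have oR2 : (fun x => R x ^ 2) =O[atTop] (1 : ℝ → ℝ) :=
    (oR.mul_one_one oR).congr_left fun x => by ring
  have oζ2 : (fun x => ζ x ^ 2) =O[atTop] (1 : ℝ → ℝ) :=
    (oζ.mul_one_one oζ).congr_left fun x => by ring
  have oR' : (fun x => m - 2 * γ * R x - R x ^ 2 - F x + δ x) =O[atTop] (1 : ℝ → ℝ) :=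
    ((((oc m).sub ((oc (2 * γ)).mul_one_one oR)).sub oR2).sub oF).add oδ
  have oh : (fun x => R x ^ 2 - m + F x) =O[atTop] (1 : ℝ → ℝ) := (oR2.sub (oc m)).add oF
  -- the energy and its dissipation
  set E : ℝ → ℝ := fun x => ζ x ^ 2 * (R x ^ 2 - m) / 2 + ζ x ^ 2 * F x / (k + 2) with hE
  set g : ℝ → ℝ := fun x => -(2 * γ) * (ζ x ^ 2 * R x ^ 2) with hg
  set h : ℝ → ℝ := fun x => ζ x ^ 2 * R x * δ x + ζ x ^ 2 * (R x ^ 2 - m + F x) * e x with hh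
  have hEd : ∀ᶠ x in atTop, HasDerivAt E (g x + h x) x := by
    filter_upwards [hζd, hRd, hFd] with x h1 h2 h3
    refine ((((h1.pow 2).mul ((h2.pow 2).sub_const m)).div_const 2).add
      (((h1.pow 2).mul h3).div_const ((k : ℝ) + 2))).congr_deriv ?_
    simp only [hg, hh, Pi.pow_apply]
    field_simp
    ring
  have hhlim : Tendsto h atTop (𝓝 0) := by
    simpa using ((oζ2.mul_one_one oR).mul_tendsto_zero hδ0).add
      ((oζ2.mul_one_one oh).mul_tendsto_zero he0)
  have hElim : ∃ L, Tendsto E atTop (𝓝 L) := by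
    set K₁ : ℝ := Z ^ 2 * |b| with hK₁
    set K₂ : ℝ := Z ^ 2 * (1 + B) * (C / k) with hK₂
    have hhle : ∀ᶠ x in atTop, h x ≤ K₁ * w x + K₂ * Real.exp (-x) := by
      filter_upwards [hζZ, hR1, H.w_pos, H.w_lim.eventually_le_const one_pos, hB, H.F_pos,
        H.η_mem] with x h1 h2 h3 h4 h5 h6 h7
      have hz2 : ζ x ^ 2 ≤ Z ^ 2 := pow_le_pow_left₀ (hζ0 x).le h1 2
      have hR2 : R x ^ 2 ≤ 1 := by rw [← sq_abs]; exact pow_le_one₀ (abs_nonneg _) h2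
      have hw2 : w x ^ 2 ≤ w x := by nlinarith
      refine add_le_add ?_ ?_
      · calc ζ x ^ 2 * R x * δ x ≤ |ζ x ^ 2 * R x * δ x| := le_abs_self _
          _ = ζ x ^ 2 * |R x| * (|b| * w x ^ 2) := by
            simp [hδ, abs_mul]
          _ ≤ Z ^ 2 * 1 * (|b| * w x) := by gcongr
          _ = K₁ * w x := by rw [hK₁]; ring
      · have h8 : R x ^ 2 - m + F x ≤ 1 + B := by linarith
        have h9 : e x ≤ C / k * Real.exp (-x) := by
          simp only [he]
          rw [div_mul_eq_mul_div]
          exact div_le_div_of_nonneg_right h7.2 hk0.le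
        have h10 : 0 ≤ e x := div_nonneg h7.1 hk0.le
        calc ζ x ^ 2 * (R x ^ 2 - m + F x) * e x ≤ ζ x ^ 2 * (1 + B) * e x := by gcongr
          _ ≤ Z ^ 2 * (1 + B) * (C / k * Real.exp (-x)) := by gcongr
          _ = _ := by rw [hK₂]; ring
    have hexp : Tendsto (fun x => K₂ * Real.exp (-x)) atTop (𝓝 0) := by
      simpa using Real.tendsto_exp_neg_atTop_nhds_zero.const_mul K₂
    have hcorr : Tendsto (fun x => K₁ * τ x - K₂ * Real.exp (-x)) atTop (𝓝 (K₁ * T - 0)) :=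
      (hT.const_mul K₁).sub hexp
    obtain ⟨L, hL⟩ := exists_tendsto_of_deriv_nonpos
      (f := fun x => E x - (K₁ * τ x - K₂ * Real.exp (-x)))
      (f' := fun x => (g x + h x) - (K₁ * w x + K₂ * Real.exp (-x)))
      (B := -Z ^ 2 - (K₁ * T + 1))
      (by
        filter_upwards [hEd, H.τ_deriv] with x h1 h2
        refine (h1.sub ((h2.const_mul K₁).sub
          (((hasDerivAt_id x).neg.exp).const_mul K₂))).congr_deriv ?_
        simp only [Pi.neg_apply, id]
        ring)
      (by
        filter_upwards [hhle] with x h1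
        have : g x ≤ 0 := by
          have : 0 ≤ 2 * γ * (ζ x ^ 2 * R x ^ 2) := by positivity
          simp only [hg]; linarith
        linarith)
      (by
        filter_upwards [hζZ, H.F_pos,
          hcorr.eventually_le_const (show K₁ * T - 0 < K₁ * T + 1 by linarith)] with x h1 h2 h3
        have hz2 : ζ x ^ 2 ≤ Z ^ 2 := pow_le_pow_left₀ (hζ0 x).le h1 2
        have h4 : 0 ≤ ζ x ^ 2 * R x ^ 2 := by positivity
        have h5 : 0 ≤ ζ x ^ 2 * F x / (k + 2) := by positivity
        have h6 : ζ x ^ 2 * m ≤ Z ^ 2 * 1 := by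
          gcongr; linarith
        have h7 : 0 ≤ ζ x ^ 2 * m := by positivity
        simp only [hE]
        nlinarith)
    exact ⟨_, (hL.add hcorr).congr fun x => by ring⟩
  obtain ⟨L, hL⟩ := hElim
  -- first application of Barbalat's lemma: the dissipation vanishes
  have hglim : Tendsto g atTop (𝓝 0) := by
    refine tendsto_zero_of_hasDerivAt_add (g' := fun x => -(2 * γ) *
      ((ζ x ^ 2 * R x ^ 2) * (2 * (R x + e x)) + ζ x ^ 2 * R x *
        (2 * (m - 2 * γ * R x - R x ^ 2 - F x + δ x)))) hL hEd hhlim ?_ ?_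
    · filter_upwards [hζd, hRd] with x h1 h2
      refine (((h1.pow 2).mul (h2.pow 2)).const_mul (-(2 * γ))).congr_deriv ?_
      simp only [Pi.pow_apply]
      ring
    · exact (oc _).mul_one_one (((oζ2.mul_one_one oR2).mul_one_one ((oc 2).mul_one_one oRe)).add
        ((oζ2.mul_one_one oR).mul_one_one ((oc 2).mul_one_one oR')))
  have hζR2 : Tendsto (fun x => (ζ x * R x) ^ 2) atTop (𝓝 0) := by
    have := hglim.const_mul (-(2 * γ))⁻¹
    rw [mul_zero] at this
    refine this.congr fun x => ?_
    simp only [hg]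
    field_simp
  have hζR : Tendsto (fun x => ζ x * R x) atTop (𝓝 0) := by
    have := hζR2.sqrt
    simp only [Real.sqrt_sq_eq_abs, Real.sqrt_zero] at this
    exact (tendsto_zero_iff_abs_tendsto_zero _).2 this
  -- second application: `ζ (m - F)`, the undamped part of `(ζ R)'`, vanishes
  have hζmF : Tendsto (fun x => ζ x * (m - F x)) atTop (𝓝 0) := by
    refine tendsto_zero_of_hasDerivAt_add
      (g' := fun x => ζ x * (R x + e x) * (m - F x) - ζ x * (F x * (k * (R x + e x))))
      (h := fun x => e x * (ζ x * R x) + -(2 * γ) * (ζ x * R x) + ζ x * δ x) hζR ?_ ?_ ?_ ?_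
    · filter_upwards [hζd, hRd] with x h1 h2
      refine (h1.mul h2).congr_deriv ?_
      ring
    · simpa using ((oe.mul_tendsto_zero hζR).add ((oc (-(2 * γ))).mul_tendsto_zero hζR)).add
        (oζ.mul_tendsto_zero hδ0)
    · filter_upwards [hζd, hFd] with x h1 h2
      refine (h1.mul (h2.const_sub m)).congr_deriv ?_
      ring
    · exact ((oζ.mul_one_one oRe).mul_one_one ((oc m).sub oF)).sub
        (oζ.mul_one_one (oF.mul_one_one ((oc k).mul_one_one oRe)))
  have hζ2mF : Tendsto (fun x => ζ x * (ζ x * (m - F x))) atTop (𝓝 0) :=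
    oζ.mul_tendsto_zero hζmF
  -- so the energy is asymptotically a nonzero multiple of `ζ²`
  have hc : m * (1 / (k + 2) - 1 / 2) ≠ 0 := by
    refine mul_ne_zero hm0.ne' ?_
    have : 1 / ((k : ℝ) + 2) < 1 / 2 := one_div_lt_one_div_of_lt two_pos (by linarith)
    linarith
  have hζ2 : ∃ l, Tendsto (fun x => ζ x ^ 2) atTop (𝓝 l) := by
    refine ⟨_, (((hL.sub (hζR2.div_const 2)).add (hζ2mF.div_const ((k : ℝ) + 2))).div_const
      (m * (1 / (k + 2) - 1 / 2))).congr fun x => ?_⟩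
    rw [div_eq_iff hc]
    simp only [hE]
    field_simp
    ring
  obtain ⟨l, hl⟩ := hζ2
  have hζl : Tendsto ζ atTop (𝓝 (√l)) :=
    hl.sqrt.congr fun x => Real.sqrt_sq (hζ0 x).le
  exact ⟨_, (hζl.pow k).congr' (hζF.mono fun x hx => hx.symm)⟩

/-- For `n = 3`, `J = 2` the function `F` increases to a positive limit; then `P → p < 1`, and
`(log F)' → 1 - p > 0` contradicts convergence. -/
theorem not_three_two (H : RescaledSystem 3 2 b C P F w τ η) : False := by
  obtain ⟨L, hL0, hL⟩ := H.exists_tendsto_F_of_nonneg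
    (H.P_mem.mono fun x hx => by norm_num; linarith [hx.2])
  obtain ⟨p, hp, hp1, hpL, hP⟩ := H.exists_tendsto_P hL
  have hp2 : p < 1 := lt_of_le_of_ne hp1 fun h => by subst h; simp at hpL; linarith
  have : Tendsto F atTop atTop := by
    refine tendsto_atTop_of_log_deriv (c := (1 - p) / 2) (by linarith) H.F_deriv ?_ H.F_pos
    filter_upwards [hP.eventually_lt_const (show p < (1 + p) / 2 by linarith), H.η_mem]
      with x hx hη
    norm_num
    linarith [hη.1]
  exact not_tendsto_nhds_of_tendsto_atTop this L hL

theorem not_four_three (H : RescaledSystem 4 3 b C P F w τ η) : False := by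
  obtain ⟨B, hB⟩ := H.exists_F_le
  have h : Tendsto F atTop atTop := by
    refine tendsto_atTop_of_log_deriv (c := 1) one_pos H.F_deriv ?_ H.F_pos
    filter_upwards [H.η_mem] with x hη
    norm_num
    linarith [hη.1]
  obtain ⟨x, h1, h2⟩ := (hB.and (h.eventually_gt_atTop B)).exists
  linarith

theorem two_mul_le_and_exists_tendsto (H : RescaledSystem n J b C P F w τ η) (hJ : 1 ≤ J)
    (hJn : J < n) : 2 * J ≤ n ∧ ∃ L, Tendsto F atTop (𝓝 L) := by
  have hJ' : (1 : ℝ) ≤ J := by exact_mod_cast hJ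
  rcases Nat.lt_or_ge n 5 with hn | hn
  · rcases Nat.lt_or_ge n 3 with hn3 | hn3
    · obtain ⟨rfl, rfl⟩ : n = 2 ∧ J = 1 := by omega
      exact ⟨le_rfl, 0, H.tendsto_F_of_eq_two⟩
    · obtain ⟨rfl, rfl⟩ | ⟨rfl, rfl⟩ | ⟨rfl, rfl⟩ | ⟨rfl, rfl⟩ | ⟨rfl, rfl⟩ :
          n = 3 ∧ J = 1 ∨ n = 3 ∧ J = 2 ∨ n = 4 ∧ J = 1 ∨ n = 4 ∧ J = 2 ∨ n = 4 ∧ J = 3 := by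
        omega
      · refine ⟨by norm_num, H.exists_tendsto_F_of_nonpos (H.P_mem.mono fun x hx => ?_)⟩
        norm_num
        linarith [hx.1]
      · exact H.not_three_two.elim
      · refine ⟨by norm_num, H.exists_tendsto_F_of_nonpos (H.P_mem.mono fun x hx => ?_)⟩
        norm_num
      · refine ⟨by norm_num, H.exists_tendsto_F_of_nonpos (H.P_mem.mono fun x hx => ?_)⟩
        norm_num
      · exact H.not_four_three.elim
  · have h2 := H.two_mul_lt_of_five_le hn
    refine ⟨h2.le, ?_⟩
    rcases Nat.lt_or_ge J 3 with hJ3 | hJ3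
    · refine H.exists_tendsto_F_of_nonpos (H.P_mem.mono fun x hx => ?_)
      have h5 : (5 : ℝ) ≤ n := by exact_mod_cast hn
      have h6 : (J : ℝ) ≤ 2 := by exact_mod_cast (by omega : J ≤ 2)
      nlinarith [hx.1, hx.2]
    · exact H.exists_tendsto_F_of_three_le hJ3 h2

/-- `F / w²` is, up to a constant factor, the density. If `p < 1`, then `F` has a positive limit;
if `p = 1`, then `(log (F / w²))' → J > 0`. -/
theorem tendsto_F_div_sq (H : RescaledSystem n J b C P F w τ η) (hJ : 1 ≤ J) {L p : ℝ}
    (hL : Tendsto F atTop (𝓝 L)) (hp1 : p ≤ 1) (hp : 1 / 2 ≤ p) (hpL : p * (1 - p) = L)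
    (hP : Tendsto P atTop (𝓝 p)) : Tendsto (fun x => F x / w x ^ 2) atTop atTop := by
  have hJ' : (1 : ℝ) ≤ J := by exact_mod_cast hJ
  rcases hp1.lt_or_eq with hp1 | rfl
  · have hw : Tendsto (fun x => (w x ^ 2)⁻¹) atTop atTop := by
      refine tendsto_inv_nhdsGT_zero.comp (tendsto_nhdsWithin_iff.2 ⟨?_, ?_⟩)
      · simpa using H.w_lim.pow 2
      · filter_upwards [H.w_pos] with x hx using pow_pos hx 2
    have hL0 : 0 < L := by rw [← hpL]; exact mul_pos (by linarith) (by linarith)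
    exact (hL.pos_mul_atTop hL0 hw).congr fun x => (div_eq_mul_inv _ _).symm
  · refine tendsto_atTop_of_log_deriv (c := 1 / 2)
      (r := fun x => n * P x - (n - J) + η x) (by norm_num) ?_ ?_ ?_
    · filter_upwards [H.F_deriv, H.w_deriv, H.w_pos] with x h1 h2 h3
      refine (h1.div (h2.pow 2) (pow_pos h3 2).ne').congr_deriv ?_
      simp only [Pi.pow_apply]
      field_simp
      ring
    · have : Tendsto (fun x => (n : ℝ) * P x - (n - J)) atTop (𝓝 (n * 1 - (n - J))) :=
        (hP.const_mul _).sub_const _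
      filter_upwards [this.eventually_const_lt (show (1 / 2 : ℝ) < n * 1 - (n - J) by linarith),
        H.η_mem] with x h1 h2
      linarith [h2.1]
    · filter_upwards [H.F_pos, H.w_pos] with x h1 h2
      positivity

/-- The asymptotics of the rescaled system. -/
theorem asymptotics (H : RescaledSystem n J b C P F w τ η) (hJ : 1 ≤ J) (hJn : J < n) :
    2 * J ≤ n ∧ (∃ p, 1 / 2 ≤ p ∧ p ≤ 1 ∧ Tendsto P atTop (𝓝 p)) ∧
      Tendsto (fun x => F x / w x ^ 2) atTop atTop := by
  obtain ⟨h2, L, hL⟩ := H.two_mul_le_and_exists_tendsto hJ hJn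
  obtain ⟨p, hp, hp1, hpL, hP⟩ := H.exists_tendsto_P hL
  exact ⟨h2, ⟨p, hp, hp1, hP⟩, H.tendsto_F_div_sq hJ hL hp1 hp hpL hP⟩

end RescaledSystem

/-! ### Continuation of bounded solutions -/

/-- Concatenation of solutions: the one-sided derivatives match at `T` because `f'` extends
continuously to `T` with value `g' T`. -/
theorem hasDerivWithinAt_glue {f g f' g' : ℝ → ℝ} {T T' : ℝ} (hT : 0 < T) (hT' : T < T')
    (hf : ∀ t ∈ Set.Ico 0 T, HasDerivWithinAt f (f' t) (Set.Ico 0 T) t)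
    (hg : ∀ t ∈ Set.Ico T T', HasDerivAt g (g' t) t)
    (hfg : Tendsto f (𝓝[<] T) (𝓝 (g T))) (hfg' : Tendsto f' (𝓝[<] T) (𝓝 (g' T))) :
    ∀ t ∈ Set.Ico 0 T', HasDerivWithinAt (fun t => if t < T then f t else g t)
      (if t < T then f' t else g' t) (Set.Ico 0 T') t := by
  intro t ht
  rcases lt_trichotomy t T with h | rfl | h
  · rw [if_pos h]
    have hmem : Set.Ico 0 T ∈ 𝓝[Set.Ico 0 T'] t := by
      filter_upwards [self_mem_nhdsWithin, mem_nhdsWithin_of_mem_nhds (Iio_mem_nhds h)] with s h1 h2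
      exact ⟨h1.1, h2⟩
    refine ((hf t ⟨ht.1, h⟩).mono_of_mem_nhdsWithin hmem).congr_of_eventuallyEq ?_ (if_pos h)
    filter_upwards [mem_nhdsWithin_of_mem_nhds (Iio_mem_nhds h)] with s hs using if_pos hs
  · rw [if_neg (lt_irrefl t)]
    have hr : HasDerivWithinAt (fun s => if s < t then f s else g s) (g' t) (Set.Ici t) t :=
      (hg t ⟨le_rfl, hT'⟩).hasDerivWithinAt.congr (fun s hs => if_neg (not_lt.2 hs))
        (if_neg (lt_irrefl t))
    have hd : ∀ s ∈ Set.Ioo 0 t, HasDerivAt (fun s => if s < t then f s else g s) (f' s) s := by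
      intro s hs
      refine ((hf s ⟨hs.1.le, hs.2⟩).hasDerivAt (Ico_mem_nhds hs.1 hs.2)).congr_of_eventuallyEq ?_
      filter_upwards [Iio_mem_nhds hs.2] with u hu using if_pos hu
    have hev : ∀ᶠ s in 𝓝[<] t, s ∈ Set.Ioo 0 t := Ioo_mem_nhdsLT hT
    have hl : HasDerivWithinAt (fun s => if s < t then f s else g s) (g' t) (Set.Iic t) t := by
      refine hasDerivWithinAt_Iic_of_tendsto_deriv (s := Set.Ioo 0 t)
        (fun s hs => (hd s hs).differentiableAt.differentiableWithinAt) ?_ hev ?_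
      · have : Tendsto (fun s => if s < t then f s else g s) (𝓝[Set.Ioo 0 t] t)
            (𝓝 (if t < t then f t else g t)) := by
          rw [if_neg (lt_irrefl t)]
          refine (hfg.mono_left (nhdsWithin_mono t Set.Ioo_subset_Iio_self)).congr' ?_
          filter_upwards [self_mem_nhdsWithin] with s hs using (if_pos hs.2).symm
        exact this
      · exact hfg'.congr' (hev.mono fun s hs => (hd s hs).deriv.symm)
    have := hl.union hr
    rw [Set.Iic_union_Ici] at this
    exact this.mono (Set.subset_univ _)
  · rw [if_neg (not_lt.2 h.le)]
    refine ((hg t ⟨h.le, ht.2⟩).congr_of_eventuallyEq ?_).hasDerivWithinAt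
    filter_upwards [Ioi_mem_nhds h] with s hs using if_neg (not_lt.2 (Set.mem_Ioi.1 hs).le)

theorem exists_tendsto_of_neg_le_deriv {f f' : ℝ → ℝ} {a T M K : ℝ} (hT : a < T)
    (hf : ∀ t ∈ Set.Ioo a T, HasDerivAt f (f' t) t) (hf' : ∀ t ∈ Set.Ioo a T, -K ≤ f' t)
    (hM : ∀ t ∈ Set.Ioo a T, f t ≤ M) : ∃ L, Tendsto f (𝓝[<] T) (𝓝 L) := by
  have hm : MonotoneOn (fun t => f t + K * t) (Set.Ioo a T) :=
    monotoneOn_of_hasDerivAt_nonneg (convex_Ioo a T) (f' := fun t => f' t + K * 1)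
      (fun t ht => (hf t ht).add ((hasDerivAt_id t).const_mul K))
      (fun t ht => by linarith [hf' t ht])
  have := hm.tendsto_nhdsWithin_Ioo_left (Set.nonempty_Ioo.2 hT)
    ⟨M + |K| * max |a| |T|, by
      rintro _ ⟨t, ht, rfl⟩
      have h1 : K * t ≤ |K| * max |a| |T| :=
        (le_abs_self _).trans (by rw [abs_mul]; gcongr; exact abs_le_max_abs_abs ht.1.le ht.2.le)
      linarith [hM t ht]⟩
  have hc : Tendsto (fun t => K * t) (𝓝[<] T) (𝓝 (K * T)) :=
    (continuous_const.mul continuous_id).continuousAt.tendsto.mono_left nhdsWithin_le_nhds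
  exact ⟨_, (this.sub hc).congr fun t => by simp⟩

/-- A solution that is bounded on `[0, T)` extends beyond `T`. -/
theorem IsMaximalREPSolution.not_bounded {n : ℕ} {k cb : ℝ} {lam0 : Fin n → ℝ} {ρ0 T : ℝ}
    {lam : Fin n → ℝ → ℝ} {ρ : ℝ → ℝ} (H : IsMaximalREPSolution k cb lam0 ρ0 T lam ρ)
    (hT : 0 < T) {M : ℝ} (hlam : ∀ i, ∀ t ∈ Set.Ico 0 T, |lam i t| ≤ M)
    (hρ : ∀ t ∈ Set.Ico 0 T, |ρ t| ≤ M) : False := by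
  have hM : 0 ≤ M := (abs_nonneg _).trans (hρ 0 ⟨le_rfl, hT⟩)
  have hS := H.isSolution
  have hsub : Set.Ioo 0 T ⊆ Set.Ico 0 T := Set.Ioo_subset_Ico_self
  have hlim : ∀ i, ∃ L, Tendsto (lam i) (𝓝[<] T) (𝓝 L) := by
    intro i
    refine exists_tendsto_of_neg_le_deriv (M := M) (K := M ^ 2 + |k / n| * (M + |cb|)) hT
      (fun t ht => (hS.lam_deriv i t (hsub ht)).hasDerivAt (Ico_mem_nhds ht.1 ht.2))
      (fun t ht => ?_) (fun t ht => (abs_le.1 (hlam i t (hsub ht))).2)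
    have h1 : lam i t ^ 2 ≤ M ^ 2 := by
      rw [← sq_abs]; exact pow_le_pow_left₀ (abs_nonneg _) (hlam i t (hsub ht)) 2
    have h2 : |k / n * (ρ t - cb)| ≤ |k / n| * (M + |cb|) := by
      rw [abs_mul]
      gcongr
      exact (abs_sub _ _).trans (by gcongr; exact hρ t (hsub ht))
    linarith [(abs_le.1 h2).1]
  choose Λ hΛ using hlim
  have hlimρ : ∃ L, Tendsto ρ (𝓝[<] T) (𝓝 L) := by
    refine exists_tendsto_of_neg_le_deriv (M := M) (K := M * ∑ _i : Fin n, M) hT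
      (fun t ht => (hS.rho_deriv t (hsub ht)).hasDerivAt (Ico_mem_nhds ht.1 ht.2))
      (fun t ht => ?_) (fun t ht => (abs_le.1 (hρ t (hsub ht))).2)
    have h2 : |-(ρ t) * ∑ i, lam i t| ≤ M * ∑ _i : Fin n, M := by
      rw [abs_mul, abs_neg]
      gcongr
      · exact hρ t (hsub ht)
      · exact (Finset.abs_sum_le_sum_abs _ _).trans
          (Finset.sum_le_sum fun i _ => hlam i t (hsub ht))
    exact (abs_le.1 h2).1
  obtain ⟨r, hr⟩ := hlimρ
  let V : (Fin n → ℝ) × ℝ → (Fin n → ℝ) × ℝ := fun y =>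
    (fun i => -(y.1 i) ^ 2 + k / n * (y.2 - cb), -y.2 * ∑ i, y.1 i)
  have hV : ContDiff ℝ 1 V := by
    refine ContDiff.prodMk (contDiff_pi.2 fun i => ?_) ?_ <;> fun_prop
  obtain ⟨α, hα0, ε, hε, hα⟩ :=
    ContDiffAt.exists_forall_mem_closedBall_exists_eq_forall_mem_Ioo_hasDerivAt₀
      (hV.contDiffAt (x := (Λ, r))) T
  have hα' : ∀ t ∈ Set.Ico T (T + ε), HasDerivAt α (V (α t)) t := fun t ht =>
    hα t ⟨by linarith [ht.1], ht.2⟩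
  refine H.maximal (T + ε) (fun i t => if t < T then lam i t else (α t).1 i)
    (fun t => if t < T then ρ t else (α t).2) (by linarith) ⟨?_, ?_, ?_, ?_⟩ ⟨?_, ?_⟩
  · intro i; simp only [if_pos hT]; exact hS.lam_init i
  · simp only [if_pos hT]; exact hS.rho_init
  · intro i t ht
    refine (hasDerivWithinAt_glue hT (by linarith : T < T + ε) (hS.lam_deriv i)
      (g := fun t => (α t).1 i) (g' := fun t => (V (α t)).1 i) (fun s hs => ?_) ?_ ?_ t
      ht).congr_deriv ?_
    · exact (hasDerivAt_pi.1 (hα' s hs).fst) i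
    · rw [hα0]; exact hΛ i
    · rw [hα0]
      exact ((hΛ i).pow 2).neg.add ((hr.sub_const cb).const_mul _)
    · split_ifs <;> rfl
  · intro t ht
    refine (hasDerivWithinAt_glue hT (by linarith : T < T + ε) hS.rho_deriv
      (g := fun t => (α t).2) (g' := fun t => (V (α t)).2) (fun s hs => ?_) ?_ ?_ t
      ht).congr_deriv ?_
    · exact (hα' s hs).snd
    · rw [hα0]; exact hr
    · rw [hα0]
      exact hr.neg.mul (tendsto_finsetSum _ fun i _ => hΛ i)
    · split_ifs <;> rfl
  · intro i t ht; exact if_pos ht.2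
  · intro t ht; exact if_pos ht.2

/-! ### Scalar functions on `[0, T)` -/

theorem eventually_Ioo_of_nhdsLT {T : ℝ} (hT : 0 < T) {p : ℝ → Prop} (hp : ∀ᶠ t in 𝓝[<] T, p t) :
    ∃ l, 0 < l ∧ l < T ∧ ∀ t ∈ Set.Ico l T, p t := by
  obtain ⟨l, hl, hsub⟩ := (mem_nhdsLT_iff_exists_Ioo_subset' hT).1 hp
  refine ⟨(max l 0 + T) / 2, ?_, ?_, fun t ht => hsub ⟨?_, ht.2⟩⟩
  · have := le_max_right l 0; linarith
  · have : max l 0 < T := max_lt hl hT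
    linarith
  · have := le_max_left l 0
    have h2 : max l 0 < T := max_lt hl hT
    linarith [ht.1]

theorem monotoneOn_Ico_of_deriv_nonneg {f f' : ℝ → ℝ} {T : ℝ}
    (hf : ∀ t ∈ Set.Ico 0 T, HasDerivWithinAt f (f' t) (Set.Ico 0 T) t)
    (hf' : ∀ t ∈ Set.Ico 0 T, 0 ≤ f' t) : MonotoneOn f (Set.Ico 0 T) := by
  have hd : ∀ t ∈ interior (Set.Ico 0 T), HasDerivAt f (f' t) t := fun t ht =>
    (hf t (interior_subset ht)).hasDerivAt (mem_interior_iff_mem_nhds.1 ht)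
  refine monotoneOn_of_deriv_nonneg (convex_Ico 0 T) (fun t ht => (hf t ht).continuousWithinAt)
    (fun t ht => (hd t ht).differentiableAt.differentiableWithinAt) fun t ht => ?_
  rw [(hd t ht).deriv]
  exact hf' t (interior_subset ht)

theorem eq_of_deriv_eq_zero_Ico {f f' : ℝ → ℝ} {T : ℝ}
    (hf : ∀ t ∈ Set.Ico 0 T, HasDerivWithinAt f (f' t) (Set.Ico 0 T) t)
    (hf' : ∀ t ∈ Set.Ico 0 T, f' t = 0) {t : ℝ} (ht : t ∈ Set.Ico 0 T) : f t = f 0 := by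
  have h0 : (0 : ℝ) ∈ Set.Ico 0 T := ⟨le_rfl, ht.1.trans_lt ht.2⟩
  have h1 := monotoneOn_Ico_of_deriv_nonneg hf (fun t ht => (hf' t ht).ge) h0 ht ht.1
  have h2 := monotoneOn_Ico_of_deriv_nonneg (fun t ht => (hf t ht).neg)
    (fun t ht => by rw [hf' t ht, neg_zero]) h0 ht ht.1
  simp only [Pi.neg_apply] at h2
  linarith

theorem hasDerivWithinAt_primitive {f : ℝ → ℝ} {T : ℝ} (hf : ContinuousOn f (Set.Ico 0 T)) {t : ℝ}
    (ht : t ∈ Set.Ico 0 T) :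
    HasDerivWithinAt (fun t => ∫ s in (0 : ℝ)..t, f s) (f t) (Set.Ico 0 T) t := by
  -- replace `f` by a function that is continuous on the whole line and agrees with `f` on `[0, r]`
  obtain ⟨r, hr1, hr2⟩ := exists_between ht.2
  have hr0 : 0 ≤ r := ht.1.trans hr1.le
  set g : ℝ → ℝ := Set.IccExtend hr0 ((Set.Icc 0 r).domRestrict f) with hg
  have hgc : Continuous g :=
    (hf.mono fun s hs => ⟨hs.1, hs.2.trans_lt hr2⟩).domRestrict.Icc_extend'
  have hgf : ∀ s ∈ Set.Icc 0 r, g s = f s := fun s hs => by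
    rw [hg, Set.IccExtend_of_mem hr0 _ hs]; rfl
  have h := (hgc.integral_hasStrictDerivAt 0 t).hasDerivAt.hasDerivWithinAt (s := Set.Ico 0 T)
  rw [hgf t ⟨ht.1, hr1.le⟩] at h
  have heq : ∀ s ∈ Set.Icc 0 r, ∫ u in (0 : ℝ)..s, f u = ∫ u in (0 : ℝ)..s, g u := by
    intro s hs
    refine intervalIntegral.integral_congr fun u hu => ?_
    rw [Set.uIcc_of_le hs.1] at hu
    exact (hgf u ⟨hu.1, hu.2.trans hs.2⟩).symm
  refine h.congr_of_eventuallyEq ?_ (heq t ⟨ht.1, hr1.le⟩)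
  filter_upwards [self_mem_nhdsWithin, mem_nhdsWithin_of_mem_nhds (Iio_mem_nhds hr1)] with s h1 h2
  exact heq s ⟨h1.1, (Set.mem_Iio.1 h2).le⟩

theorem intervalIntegrable_of_continuousOn_Ico {f : ℝ → ℝ} {T : ℝ}
    (hf : ContinuousOn f (Set.Ico 0 T)) {t : ℝ} (ht : t ∈ Set.Ico 0 T) :
    IntervalIntegrable f MeasureTheory.volume 0 t := by
  refine (hf.mono fun s hs => ?_).intervalIntegrable
  rw [Set.uIcc_of_le ht.1] at hs
  exact ⟨hs.1, hs.2.trans_lt ht.2⟩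

theorem monotoneOn_arctan {f f' : ℝ → ℝ} {T ω : ℝ} (hω : 0 < ω)
    (hf : ∀ t ∈ Set.Ico 0 T, HasDerivWithinAt f (f' t) (Set.Ico 0 T) t)
    (hf' : ∀ t ∈ Set.Ico 0 T, -f t ^ 2 - ω ^ 2 ≤ f' t) :
    MonotoneOn (fun t => Real.arctan (f t / ω) + ω * t) (Set.Ico 0 T) := by
  refine monotoneOn_Ico_of_deriv_nonneg (f' := fun t =>
    1 / (1 + (f t / ω) ^ 2) * (f' t / ω) + ω * 1)
    (fun t ht => ((hf t ht).div_const ω).arctan.add ((hasDerivWithinAt_id t _).const_mul ω))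
    (fun t ht => ?_)
  have h := hf' t ht
  have h2 : 1 / (1 + (f t / ω) ^ 2) * (f' t / ω) + ω * 1
      = ω * (f' t + f t ^ 2 + ω ^ 2) / (ω ^ 2 + f t ^ 2) := by
    have : ω ^ 2 + f t ^ 2 ≠ 0 := by positivity
    have h3 : 1 + (f t / ω) ^ 2 ≠ 0 := by positivity
    field_simp
    ring
  rw [h2]
  have : 0 ≤ f' t + f t ^ 2 + ω ^ 2 := by linarith
  positivity

/-- A function with `f' ≥ - f² - ω²` on `[0, T)` has a limit in `[-∞, ∞]` at `T`, because
`arctan (f / ω) + ω t` is monotone and bounded. -/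
theorem tendsto_trichotomy {f f' : ℝ → ℝ} {T ω : ℝ} (hT : 0 < T) (hω : 0 < ω)
    (hf : ∀ t ∈ Set.Ico 0 T, HasDerivWithinAt f (f' t) (Set.Ico 0 T) t)
    (hf' : ∀ t ∈ Set.Ico 0 T, -f t ^ 2 - ω ^ 2 ≤ f' t) :
    Tendsto f (𝓝[<] T) atBot ∨ Tendsto f (𝓝[<] T) atTop ∨ ∃ L, Tendsto f (𝓝[<] T) (𝓝 L) := by
  have hm := (monotoneOn_arctan hω hf hf').mono (Set.Ioo_subset_Ico_self)
  have h1 := hm.tendsto_nhdsWithin_Ioo_left (Set.nonempty_Ioo.2 hT)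
    ⟨Real.pi / 2 + ω * T, by
      rintro _ ⟨t, ht, rfl⟩
      have := Real.arctan_lt_pi_div_two (f t / ω)
      have : ω * t ≤ ω * T := by gcongr; exact ht.2.le
      simp only
      linarith⟩
  have hc : Tendsto (fun t => ω * t) (𝓝[<] T) (𝓝 (ω * T)) :=
    (continuous_const.mul continuous_id).continuousAt.tendsto.mono_left nhdsWithin_le_nhds
  obtain ⟨l, hl⟩ : ∃ l, Tendsto (fun t => Real.arctan (f t / ω)) (𝓝[<] T) (𝓝 l) :=
    ⟨_, (h1.sub hc).congr fun t => by simp⟩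
  have hl1 : l ≤ Real.pi / 2 := le_of_tendsto hl
    (Eventually.of_forall fun t => (Real.arctan_lt_pi_div_two _).le)
  have hl2 : -(Real.pi / 2) ≤ l := ge_of_tendsto hl
    (Eventually.of_forall fun t => (Real.neg_pi_div_two_lt_arctan _).le)
  rcases hl2.eq_or_lt with h | hl2
  · left
    refine tendsto_atBot.2 fun b => ?_
    filter_upwards [hl.eventually_lt_const (h ▸ Real.neg_pi_div_two_lt_arctan (b / ω))] with t ht
    have := (div_lt_div_iff_of_pos_right hω).1 (Real.arctan_strictMono.lt_iff_lt.1 ht)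
    exact this.le
  rcases hl1.eq_or_lt with h | hl1
  · right; left
    refine tendsto_atTop.2 fun b => ?_
    filter_upwards [hl.eventually_const_lt (h ▸ Real.arctan_lt_pi_div_two (b / ω))] with t ht
    have := (div_lt_div_iff_of_pos_right hω).1 (Real.arctan_strictMono.lt_iff_lt.1 ht)
    exact this.le
  · right; right
    have htan := (Real.continuousAt_tan.2 (Real.cos_pos_of_mem_Ioo ⟨hl2, hl1⟩).ne').tendsto.comp hl
    refine ⟨ω * Real.tan l, (htan.const_mul ω).congr fun t => ?_⟩
    simp only [Function.comp, Real.tan_arctan]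
    field_simp

/-- A derivative bounded below by a multiple of `1 / (T - t)` forces logarithmic divergence. -/
theorem tendsto_atTop_of_deriv_ge_inv {f f' : ℝ → ℝ} {T c K : ℝ} (hT : 0 < T) (hc : 0 < c)
    (hf : ∀ t ∈ Set.Ioo 0 T, HasDerivAt f (f' t) t)
    (hf' : ∀ᶠ t in 𝓝[<] T, c / (T - t) - K ≤ f' t) : Tendsto f (𝓝[<] T) atTop := by
  obtain ⟨l, hl0, hlT, hl⟩ := eventually_Ioo_of_nhdsLT hT hf'
  have hm : MonotoneOn (fun t => f t + (c * Real.log (T - t) + K * t)) (Set.Ico l T) := by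
    refine monotoneOn_of_hasDerivAt_nonneg (convex_Ico l T)
      (f' := fun t => f' t + (c * (-1 / (T - t)) + K * 1)) (fun t ht => ?_) (fun t ht => ?_)
    · exact (hf t ⟨hl0.trans_le ht.1, ht.2⟩).add (((((hasDerivAt_id t).const_sub T).log
        (sub_pos.2 ht.2).ne').const_mul c).add ((hasDerivAt_id t).const_mul K))
    · have := hl t ht
      have h2 : c * (-1 / (T - t)) = -(c / (T - t)) := by ring
      linarith
  have hlog : Tendsto (fun t => -(c * Real.log (T - t))) (𝓝[<] T) atTop := by
    have h1 : Tendsto (fun t => T - t) (𝓝[<] T) (𝓝[>] 0) := by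
      refine tendsto_nhdsWithin_iff.2 ⟨?_, ?_⟩
      · have : Tendsto (fun t => T - t) (𝓝 T) (𝓝 (T - T)) := by
          exact (continuous_const.sub continuous_id).tendsto T
        rw [sub_self] at this
        exact this.mono_left nhdsWithin_le_nhds
      · filter_upwards [self_mem_nhdsWithin] with t ht using sub_pos.2 (Set.mem_Iio.1 ht)
    exact tendsto_neg_atBot_atTop.comp ((Real.tendsto_log_nhdsGT_zero.comp h1).const_mul_atBot hc)
  refine tendsto_atTop_mono' _ ?_
    (tendsto_atTop_add_const_right _ (f l + (c * Real.log (T - l) + K * l) - |K| * T) hlog)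
  filter_upwards [Ico_mem_nhdsLT hlT] with t ht
  have h1 := hm (Set.left_mem_Ico.2 hlT) ht ht.1
  have h2 : K * t ≤ |K| * T :=
    mul_le_mul (le_abs_self K) ht.2.le (hl0.le.trans ht.1) (abs_nonneg K)
  simp only at h1
  linarith

/-- If `U' / U → -∞` at `T` and `U'' ≥ -K U`, then `U'` is bounded and `U` vanishes at least
linearly. -/
theorem linear_decay {f U r : ℝ → ℝ} {T K : ℝ} (hT : 0 < T) (hK : 0 ≤ K)
    (hU : ∀ t ∈ Set.Ioo 0 T, HasDerivAt U (f t * U t) t)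
    (hfU : ∀ t ∈ Set.Ioo 0 T, HasDerivAt (fun t => f t * U t) (r t * U t) t)
    (hr : ∀ t ∈ Set.Ioo 0 T, -K ≤ r t) (hpos : ∀ t ∈ Set.Ioo 0 T, 0 < U t)
    (hf : Tendsto f (𝓝[<] T) atBot) :
    ∃ M > 0, ∀ᶠ t in 𝓝[<] T, U t ≤ M * (T - t) ∧ |f t * U t| ≤ M := by
  obtain ⟨l, hl0, hlT, hl⟩ := eventually_Ioo_of_nhdsLT hT (hf.eventually_lt_atBot 0)
  have hsub : Set.Ico l T ⊆ Set.Ioo 0 T := fun t ht => ⟨hl0.trans_le ht.1, ht.2⟩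
  have hlm : l ∈ Set.Ico l T := Set.left_mem_Ico.2 hlT
  have hdec : ∀ t ∈ Set.Ico l T, U t ≤ U l := by
    intro t ht
    have := monotoneOn_of_hasDerivAt_nonneg (convex_Ico l T) (f := fun t => -U t)
      (f' := fun t => -(f t * U t)) (fun t ht => (hU t (hsub ht)).neg) (fun t ht => by
        have := mul_neg_of_neg_of_pos (hl t ht) (hpos t (hsub ht))
        linarith) hlm ht ht.1
    simpa using this
  have hinc : MonotoneOn (fun t => f t * U t + K * U l * t) (Set.Ico l T) := by
    refine monotoneOn_of_hasDerivAt_nonneg (convex_Ico l T)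
      (f' := fun t => r t * U t + K * U l * 1)
      (fun t ht => (hfU t (hsub ht)).add ((hasDerivAt_id t).const_mul _)) (fun t ht => ?_)
    have h1 := hr t (hsub ht)
    have h2 := hdec t ht
    have h3 := hpos t (hsub ht)
    nlinarith
  have hUl := hpos l (hsub hlm)
  have hfl : f l * U l < 0 := mul_neg_of_neg_of_pos (hl l hlm) hUl
  set M : ℝ := -(f l * U l) + K * U l * T with hM
  have hM0 : 0 < M := by
    have : 0 ≤ K * U l * T := by positivity
    linarith
  have hlow : ∀ t ∈ Set.Ico l T, -M ≤ f t * U t := by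
    intro t ht
    have h1 := hinc hlm ht ht.1
    have h2 : K * U l * t ≤ K * U l * T := by gcongr; exact ht.2.le
    have h3 : 0 ≤ K * U l * l := by positivity
    simp only at h1
    linarith
  have hzero : Tendsto U (𝓝[<] T) (𝓝 0) := by
    have h1 : Tendsto (fun t => M * (-f t)⁻¹) (𝓝[<] T) (𝓝 0) := by
      have := (tendsto_inv_atTop_zero.comp (tendsto_neg_atBot_atTop.comp hf)).const_mul M
      simpa [Function.comp_def] using this
    refine tendsto_of_tendsto_of_tendsto_of_le_of_le' tendsto_const_nhds h1 ?_ ?_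
    · filter_upwards [Ico_mem_nhdsLT hlT] with t ht using (hpos t (hsub ht)).le
    · filter_upwards [Ico_mem_nhdsLT hlT] with t ht
      have h2 : 0 < -f t := by linarith [hl t ht]
      rw [← div_eq_mul_inv, le_div_iff₀ h2]
      linarith [hlow t ht]
  have hlin : MonotoneOn (fun t => U t + M * t) (Set.Ico l T) :=
    monotoneOn_of_hasDerivAt_nonneg (convex_Ico l T) (f' := fun t => f t * U t + M * 1)
      (fun t ht => (hU t (hsub ht)).add ((hasDerivAt_id t).const_mul M))
      (fun t ht => by linarith [hlow t ht])
  have hlim : Tendsto (fun t => U t + M * t) (𝓝[<] T) (𝓝 (0 + M * T)) :=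
    hzero.add ((continuous_const.mul continuous_id).continuousAt.tendsto.mono_left
      nhdsWithin_le_nhds)
  refine ⟨M, hM0, ?_⟩
  filter_upwards [Ico_mem_nhdsLT hlT] with t ht
  constructor
  · have : U t + M * t ≤ 0 + M * T := by
      refine ge_of_tendsto hlim ?_
      filter_upwards [Ico_mem_nhdsLT ht.2] with s hs
      exact hlin ht ⟨ht.1.trans hs.1, hs.2⟩ hs.1
    linarith
  · rw [abs_le]
    have := mul_neg_of_neg_of_pos (hl t ht) (hpos t (hsub ht))
    exact ⟨hlow t ht, by linarith⟩

/-! ### Linearization of the system -/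

/-- The solution `U = exp ∫ f` of `U' = f U`, `U(0) = 1`. -/
noncomputable def expPrimitive (f : ℝ → ℝ) (t : ℝ) : ℝ := Real.exp (∫ s in (0 : ℝ)..t, f s)

theorem expPrimitive_pos (f : ℝ → ℝ) (t : ℝ) : 0 < expPrimitive f t := Real.exp_pos _

theorem expPrimitive_zero (f : ℝ → ℝ) : expPrimitive f 0 = 1 := by simp [expPrimitive]

theorem hasDerivWithinAt_expPrimitive {f : ℝ → ℝ} {T : ℝ} (hf : ContinuousOn f (Set.Ico 0 T))
    {t : ℝ} (ht : t ∈ Set.Ico 0 T) :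
    HasDerivWithinAt (expPrimitive f) (f t * expPrimitive f t) (Set.Ico 0 T) t :=
  (hasDerivWithinAt_primitive hf ht).exp.congr_deriv (mul_comm _ _)

namespace IsREPSolution

variable {n : ℕ} {k cb : ℝ} {lam0 : Fin n → ℝ} {ρ0 T : ℝ} {lam : Fin n → ℝ → ℝ} {ρ : ℝ → ℝ}

theorem continuousOn_lam (H : IsREPSolution k cb lam0 ρ0 T lam ρ) (i : Fin n) :
    ContinuousOn (lam i) (Set.Ico 0 T) := fun t ht => (H.lam_deriv i t ht).continuousWithinAt

theorem hasDerivWithinAt_U (H : IsREPSolution k cb lam0 ρ0 T lam ρ) (i : Fin n) {t : ℝ}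
    (ht : t ∈ Set.Ico 0 T) : HasDerivWithinAt (expPrimitive (lam i))
      (lam i t * expPrimitive (lam i) t) (Set.Ico 0 T) t :=
  hasDerivWithinAt_expPrimitive (H.continuousOn_lam i) ht

/-- All functions `U i = exp ∫ lam i` solve the same linear equation `U'' = k / n (ρ - cb) U`. -/
theorem hasDerivWithinAt_lam_mul_U (H : IsREPSolution k cb lam0 ρ0 T lam ρ) (i : Fin n) {t : ℝ}
    (ht : t ∈ Set.Ico 0 T) : HasDerivWithinAt (fun t => lam i t * expPrimitive (lam i) t)
      (k / n * (ρ t - cb) * expPrimitive (lam i) t) (Set.Ico 0 T) t :=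
  ((H.lam_deriv i t ht).mul (H.hasDerivWithinAt_U i ht)).congr_deriv (by ring)

/-- Integration of the continuity equation: `ρ = ρ0 / ∏ U i`. -/
theorem rho_mul_prod (H : IsREPSolution k cb lam0 ρ0 T lam ρ) {t : ℝ} (ht : t ∈ Set.Ico 0 T) :
    ρ t * ∏ i, expPrimitive (lam i) t = ρ0 := by
  have hd : ∀ t ∈ Set.Ico 0 T, HasDerivWithinAt
      (fun t => ρ t * Real.exp (∑ i, ∫ s in (0 : ℝ)..t, lam i s)) 0 (Set.Ico 0 T) t := by
    intro t ht
    refine ((H.rho_deriv t ht).mul (HasDerivWithinAt.fun_sum (u := Finset.univ) fun i _ =>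
      hasDerivWithinAt_primitive (H.continuousOn_lam i) ht).exp).congr_deriv ?_
    ring
  have := eq_of_deriv_eq_zero_Ico hd (fun _ _ => rfl) ht
  simp only [expPrimitive]
  rw [← Real.exp_sum, this]
  simp [H.rho_init]

theorem rho_pos (H : IsREPSolution k cb lam0 ρ0 T lam ρ) (hρ0 : 0 < ρ0) {t : ℝ}
    (ht : t ∈ Set.Ico 0 T) : 0 < ρ t := by
  have h := H.rho_mul_prod ht
  have hp : 0 < ∏ i, expPrimitive (lam i) t := Finset.prod_pos fun i _ => expPrimitive_pos _ _
  rw [← h] at hρ0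
  exact pos_of_mul_pos_left hρ0 hp.le

/-- Constancy of the Wronskian. -/
theorem wronskian (H : IsREPSolution k cb lam0 ρ0 T lam ρ) (i j : Fin n) {t : ℝ}
    (ht : t ∈ Set.Ico 0 T) :
    (lam i t - lam j t) * (expPrimitive (lam i) t * expPrimitive (lam j) t)
      = lam0 i - lam0 j := by
  have := eq_of_deriv_eq_zero_Ico
    (f := fun t => (lam i t - lam j t) * (expPrimitive (lam i) t * expPrimitive (lam j) t))
    (f' := fun _ => 0) (fun t ht => by
      refine (((H.lam_deriv i t ht).sub (H.lam_deriv j t ht)).mul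
        ((H.hasDerivWithinAt_U i ht).mul (H.hasDerivWithinAt_U j ht))).congr_deriv ?_
      simp only [Pi.sub_apply, Pi.mul_apply]
      ring)
    (fun _ _ => rfl) ht
  rw [this]
  simp [expPrimitive_zero, H.lam_init]

theorem lam_le (H : IsREPSolution k cb lam0 ρ0 T lam ρ) {i j : Fin n} (hij : lam0 i ≤ lam0 j)
    {t : ℝ} (ht : t ∈ Set.Ico 0 T) : lam i t ≤ lam j t := by
  have h := H.wronskian i j ht
  have hp := mul_pos (expPrimitive_pos (lam i) t) (expPrimitive_pos (lam j) t)
  by_contra! hcon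
  have := mul_pos (sub_pos.2 hcon) hp
  linarith

theorem inv_sq_continuousOn (H : IsREPSolution k cb lam0 ρ0 T lam ρ) (i : Fin n) :
    ContinuousOn (fun t => (expPrimitive (lam i) t ^ 2)⁻¹) (Set.Ico 0 T) := by
  refine ContinuousOn.inv₀ (ContinuousOn.pow (fun t ht =>
    (H.hasDerivWithinAt_U i ht).continuousWithinAt) 2) fun t _ => ?_
  exact (pow_pos (expPrimitive_pos _ _) 2).ne'

/-- Reduction of order: `U j = U i (1 + (lam0 j - lam0 i) ∫ (U i)⁻²)`. -/
theorem U_eq (H : IsREPSolution k cb lam0 ρ0 T lam ρ) (i j : Fin n) {t : ℝ}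
    (ht : t ∈ Set.Ico 0 T) : expPrimitive (lam j) t = expPrimitive (lam i) t *
      (1 + (lam0 j - lam0 i) * ∫ s in (0 : ℝ)..t, (expPrimitive (lam i) s ^ 2)⁻¹) := by
  have := eq_of_deriv_eq_zero_Ico
    (f := fun t => expPrimitive (lam j) t / expPrimitive (lam i) t -
      (lam0 j - lam0 i) * ∫ s in (0 : ℝ)..t, (expPrimitive (lam i) s ^ 2)⁻¹)
    (f' := fun _ => 0) (fun t ht => by
      have hi := expPrimitive_pos (lam i) t
      refine (((H.hasDerivWithinAt_U j ht).div (H.hasDerivWithinAt_U i ht) hi.ne').sub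
        ((hasDerivWithinAt_primitive (H.inv_sq_continuousOn i) ht).const_mul _)).congr_deriv ?_
      rw [← H.wronskian j i ht]
      field_simp
      ring)
    (fun _ _ => rfl) ht
  simp only [expPrimitive_zero, intervalIntegral.integral_same] at this
  have hi := expPrimitive_pos (lam i) t
  have h2 : expPrimitive (lam j) t / expPrimitive (lam i) t = 1 + (lam0 j - lam0 i) *
      ∫ s in (0 : ℝ)..t, (expPrimitive (lam i) s ^ 2)⁻¹ := by linarith
  rw [← h2]
  field_simp

theorem integral_inv_sq_nonneg (i : Fin n) {t : ℝ} (ht : 0 ≤ t) :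
    0 ≤ ∫ s in (0 : ℝ)..t, (expPrimitive (lam i) s ^ 2)⁻¹ :=
  intervalIntegral.integral_nonneg ht fun _ _ => by positivity

theorem lam_deriv_ge (H : IsREPSolution k cb lam0 ρ0 T lam ρ) (hk : 0 < k) (hcb : 0 < cb)
    (hρ0 : 0 < ρ0) (i : Fin n) {t : ℝ} (ht : t ∈ Set.Ico 0 T) :
    -lam i t ^ 2 - Real.sqrt (k * cb / n) ^ 2 ≤ -(lam i t) ^ 2 + k / n * (ρ t - cb) := by
  rw [Real.sq_sqrt (by positivity)]
  have h1 : 0 ≤ k / n * ρ t := mul_nonneg (by positivity) (H.rho_pos hρ0 ht).le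
  have h2 : k / n * (ρ t - cb) = k / n * ρ t - k * cb / n := by ring
  linarith

theorem trichotomy (H : IsREPSolution k cb lam0 ρ0 T lam ρ) (hT : 0 < T) (hn : 0 < n) (hk : 0 < k)
    (hcb : 0 < cb) (hρ0 : 0 < ρ0) (i : Fin n) : Tendsto (lam i) (𝓝[<] T) atBot ∨
      Tendsto (lam i) (𝓝[<] T) atTop ∨ ∃ L, Tendsto (lam i) (𝓝[<] T) (𝓝 L) :=
  tendsto_trichotomy hT (Real.sqrt_pos.2 (by have : (0 : ℝ) < n := Nat.cast_pos.2 hn; positivity))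
    (H.lam_deriv i) fun _ ht => H.lam_deriv_ge hk hcb hρ0 i ht

theorem blowup_time_le (H : IsREPSolution k cb lam0 ρ0 T lam ρ) (hT : 0 < T) (hn : 0 < n)
    (hk : 0 < k) (hcb : 0 < cb) (hρ0 : 0 < ρ0) {i : Fin n}
    (hbot : Tendsto (lam i) (𝓝[<] T) atBot) {ω : ℝ} (hω : ω = Real.sqrt (k * cb / n)) :
    1 / ω * Real.arctan (lam0 i / ω) + Real.pi / (2 * ω) ≤ T := by
  have hω0 : 0 < ω := by
    rw [hω]
    exact Real.sqrt_pos.2 (by have : (0 : ℝ) < n := Nat.cast_pos.2 hn; positivity)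
  have hm := monotoneOn_arctan hω0 (H.lam_deriv i)
    fun t ht => by rw [hω]; exact H.lam_deriv_ge hk hcb hρ0 i ht
  have h1 : Tendsto (fun t => Real.arctan (lam i t / ω) + ω * t) (𝓝[<] T)
      (𝓝 (-(Real.pi / 2) + ω * T)) :=
    ((Real.tendsto_arctan_atBot.mono_right nhdsWithin_le_nhds).comp
      (hbot.atBot_div_const hω0)).add
      ((continuous_const.mul continuous_id).continuousAt.tendsto.mono_left nhdsWithin_le_nhds)
  have h2 : Real.arctan (lam0 i / ω) ≤ -(Real.pi / 2) + ω * T := by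
    refine ge_of_tendsto h1 ?_
    filter_upwards [Ico_mem_nhdsLT hT] with t ht
    have := hm (Set.left_mem_Ico.2 hT) ht ht.1
    simpa [H.lam_init] using this
  have h3 : 1 / ω * Real.arctan (lam0 i / ω) + Real.pi / (2 * ω)
      = (Real.arctan (lam0 i / ω) + Real.pi / 2) / ω := by field_simp
  rw [h3, div_le_iff₀ hω0]
  linarith

/-- Linear decay of `U i` wherever `lam i → -∞`. -/
theorem U_decay (H : IsREPSolution k cb lam0 ρ0 T lam ρ) (hT : 0 < T) (hk : 0 < k)
    (hcb : 0 < cb) (hρ0 : 0 < ρ0) {i : Fin n} (hbot : Tendsto (lam i) (𝓝[<] T) atBot) :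
    ∃ M > 0, ∀ᶠ t in 𝓝[<] T, expPrimitive (lam i) t ≤ M * (T - t) ∧
      |lam i t * expPrimitive (lam i) t| ≤ M := by
  have hsub : Set.Ioo 0 T ⊆ Set.Ico 0 T := Set.Ioo_subset_Ico_self
  refine linear_decay hT (K := k / n * cb) (by positivity) (r := fun t => k / n * (ρ t - cb))
    (fun t ht => (H.hasDerivWithinAt_U i (hsub ht)).hasDerivAt (Ico_mem_nhds ht.1 ht.2))
    (fun t ht => (H.hasDerivWithinAt_lam_mul_U i (hsub ht)).hasDerivAt (Ico_mem_nhds ht.1 ht.2))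
    (fun t ht => ?_) (fun t _ => expPrimitive_pos _ _) hbot
  have h1 : 0 ≤ k / n * ρ t := mul_nonneg (by positivity) (H.rho_pos hρ0 (hsub ht)).le
  linarith [mul_sub (k / n) (ρ t) cb]

end IsREPSolution

theorem tendsto_mul_sub_nhdsLT (M T : ℝ) :
    Tendsto (fun t => M * (T - t)) (𝓝[<] T) (𝓝 0) := by
  have : Tendsto (fun t => M * (T - t)) (𝓝 T) (𝓝 (M * (T - T))) :=
    (continuous_const.mul (continuous_const.sub continuous_id)).tendsto T
  rw [sub_self, mul_zero] at this
  exact this.mono_left nhdsWithin_le_nhds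

namespace IsREPSolution

variable {n : ℕ} {k cb : ℝ} {lam0 : Fin n → ℝ} {ρ0 T : ℝ} {lam : Fin n → ℝ → ℝ} {ρ : ℝ → ℝ}

theorem tendsto_U_zero (H : IsREPSolution k cb lam0 ρ0 T lam ρ) (hT : 0 < T) (hk : 0 < k)
    (hcb : 0 < cb) (hρ0 : 0 < ρ0) {i : Fin n} (hbot : Tendsto (lam i) (𝓝[<] T) atBot) :
    Tendsto (expPrimitive (lam i)) (𝓝[<] T) (𝓝 0) := by
  obtain ⟨M, -, hM⟩ := H.U_decay hT hk hcb hρ0 hbot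
  exact tendsto_of_tendsto_of_tendsto_of_le_of_le' tendsto_const_nhds (tendsto_mul_sub_nhdsLT M T)
    (Eventually.of_forall fun t => (expPrimitive_pos _ _).le) (hM.mono fun t h => h.1)

/-- Two components with different initial values cannot both tend to `-∞`: their Wronskian would
vanish. -/
theorem eq_of_tendsto_atBot (H : IsREPSolution k cb lam0 ρ0 T lam ρ) (hT : 0 < T) (hk : 0 < k)
    (hcb : 0 < cb) (hρ0 : 0 < ρ0) {i j : Fin n} (hi : Tendsto (lam i) (𝓝[<] T) atBot)
    (hj : Tendsto (lam j) (𝓝[<] T) atBot) : lam0 i = lam0 j := by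
  obtain ⟨M, hM0, hM⟩ := H.U_decay hT hk hcb hρ0 hi
  obtain ⟨N, hN0, hN⟩ := H.U_decay hT hk hcb hρ0 hj
  have hlim : Tendsto (fun _ : ℝ => |lam0 i - lam0 j|) (𝓝[<] T) (𝓝 0) := by
    refine tendsto_of_tendsto_of_tendsto_of_le_of_le' tendsto_const_nhds
      (tendsto_mul_sub_nhdsLT (2 * M * N) T) (Eventually.of_forall fun t => abs_nonneg _) ?_
    filter_upwards [hM, hN, Ico_mem_nhdsLT hT] with t h1 h2 ht
    have hUi := expPrimitive_pos (lam i) t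
    have hUj := expPrimitive_pos (lam j) t
    rw [← H.wronskian i j ht]
    have : (lam i t - lam j t) * (expPrimitive (lam i) t * expPrimitive (lam j) t) =
        (lam i t * expPrimitive (lam i) t) * expPrimitive (lam j) t -
        (lam j t * expPrimitive (lam j) t) * expPrimitive (lam i) t := by ring
    rw [this]
    calc _ ≤ |(lam i t * expPrimitive (lam i) t) * expPrimitive (lam j) t| +
          |(lam j t * expPrimitive (lam j) t) * expPrimitive (lam i) t| := abs_sub _ _
      _ = |lam i t * expPrimitive (lam i) t| * expPrimitive (lam j) t +
          |lam j t * expPrimitive (lam j) t| * expPrimitive (lam i) t := by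
        rw [abs_mul (lam i t * expPrimitive (lam i) t), abs_mul (lam j t * expPrimitive (lam j) t),
          abs_of_pos hUi, abs_of_pos hUj]
      _ ≤ M * (N * (T - t)) + N * (M * (T - t)) := by
        gcongr
        exacts [h1.2, h2.1, h2.2, h1.1]
      _ = _ := by ring
  have := tendsto_nhds_unique hlim tendsto_const_nhds
  exact sub_eq_zero.1 (abs_eq_zero.1 this.symm)

/-- If `U j` is bounded for all `j ≠ i` while `U i` decays linearly, then the density
is at least of order `1 / (T - t)`. -/
theorem inv_le_rho (H : IsREPSolution k cb lam0 ρ0 T lam ρ) (hT : 0 < T) (hρ0 : 0 < ρ0)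
    {i : Fin n} {M B : ℝ} (hM : 0 < M) (hB : 0 < B)
    (hi : ∀ᶠ t in 𝓝[<] T, expPrimitive (lam i) t ≤ M * (T - t))
    (hj : ∀ᶠ t in 𝓝[<] T, ∀ j, j ≠ i → expPrimitive (lam j) t ≤ B) :
    ∃ c > 0, ∀ᶠ t in 𝓝[<] T, c / (T - t) ≤ ρ t := by
  refine ⟨ρ0 / (M * B ^ (n - 1)), by positivity, ?_⟩
  filter_upwards [hi, hj, Ico_mem_nhdsLT hT] with t h1 h2 ht
  have hTt : 0 < T - t := sub_pos.2 ht.2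
  have hprod : ∏ j, expPrimitive (lam j) t ≤ M * (T - t) * B ^ (n - 1) := by
    rw [← Finset.mul_prod_erase Finset.univ _ (Finset.mem_univ i)]
    refine mul_le_mul h1 ?_ (Finset.prod_nonneg fun _ _ => (expPrimitive_pos _ _).le)
      (by positivity)
    calc ∏ j ∈ Finset.univ.erase i, expPrimitive (lam j) t
        ≤ ∏ _j ∈ Finset.univ.erase i, B := Finset.prod_le_prod
          (fun _ _ => (expPrimitive_pos _ _).le) fun j hj => h2 j (Finset.ne_of_mem_erase hj)
      _ = B ^ (n - 1) := by simp
  have hρ := H.rho_pos hρ0 ht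
  rw [div_div, div_le_iff₀ (by positivity), ← H.rho_mul_prod ht]
  gcongr
  linarith

end IsREPSolution

namespace IsMaximalREPSolution

variable {n : ℕ} {k cb : ℝ} {lam0 : Fin n → ℝ} {ρ0 T : ℝ} {lam : Fin n → ℝ → ℝ} {ρ : ℝ → ℝ}

/-- The lowest component tends to `-∞`: otherwise all components are bounded below, hence `ρ` is
bounded above, hence all components are bounded above, and the solution extends. -/
theorem tendsto_atBot (H : IsMaximalREPSolution k cb lam0 ρ0 T lam ρ) (hT : 0 < T)
    (hk : 0 < k) (hcb : 0 < cb) (hρ0 : 0 < ρ0) {i : Fin n} (hi : ∀ j, lam0 i ≤ lam0 j) :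
    Tendsto (lam i) (𝓝[<] T) atBot := by
  have hS := H.isSolution
  have hn : 0 < n := i.pos
  by_contra hcon
  obtain ⟨b, hb⟩ : ∃ b, ∀ᶠ t in 𝓝[<] T, b ≤ lam i t := by
    rcases hS.trichotomy hT hn hk hcb hρ0 i with h | h | ⟨L, hL⟩
    · exact absurd h hcon
    · exact ⟨0, h.eventually_ge_atTop 0⟩
    · exact ⟨L - 1, hL.eventually_const_le (by linarith)⟩
  obtain ⟨l, hl0, hlT, hl⟩ := eventually_Ioo_of_nhdsLT hT hb
  obtain ⟨b', hb'⟩ := (isCompact_Icc.image_of_continuousOn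
    ((hS.continuousOn_lam i).mono (Set.Icc_subset_Ico_right hlT))).bddBelow
  set m : ℝ := |b| + |b'| with hm
  have hm0 : 0 ≤ m := by positivity
  have hlow : ∀ j, ∀ t ∈ Set.Ico 0 T, -m ≤ lam j t := by
    intro j t ht
    refine le_trans ?_ (hS.lam_le (hi j) ht)
    rcases le_total t l with h | h
    · have := hb' (Set.mem_image_of_mem _ ⟨ht.1, h⟩)
      linarith [neg_abs_le b', abs_nonneg b]
    · linarith [hl t ⟨h, ht.2⟩, neg_abs_le b, abs_nonneg b']
  have hUlow : ∀ j, ∀ t ∈ Set.Ico 0 T, Real.exp (-(m * T)) ≤ expPrimitive (lam j) t := by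
    intro j t ht
    refine Real.exp_le_exp.2 ?_
    have h1 : ∫ _s in (0 : ℝ)..t, -m ≤ ∫ s in (0 : ℝ)..t, lam j s :=
      intervalIntegral.integral_mono_on ht.1 intervalIntegrable_const
        (intervalIntegrable_of_continuousOn_Ico (hS.continuousOn_lam j) ht)
        fun s hs => hlow j s ⟨hs.1, hs.2.trans_lt ht.2⟩
    have h2 : m * t ≤ m * T := by gcongr; exact ht.2.le
    simp only [intervalIntegral.integral_const, sub_zero, smul_eq_mul] at h1
    linarith
  set R : ℝ := ρ0 / Real.exp (-(m * T)) ^ n with hR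
  have hρR : ∀ t ∈ Set.Ico 0 T, ρ t ≤ R := by
    intro t ht
    have hρ := hS.rho_pos hρ0 ht
    rw [hR, le_div_iff₀ (by positivity), ← hS.rho_mul_prod ht]
    gcongr
    calc Real.exp (-(m * T)) ^ n = ∏ _j : Fin n, Real.exp (-(m * T)) := by simp
      _ ≤ _ := Finset.prod_le_prod (fun _ _ => (Real.exp_pos _).le) fun j _ => hUlow j t ht
  have hR0 : 0 ≤ R := by positivity
  have hup : ∀ j, ∀ t ∈ Set.Ico 0 T, lam j t ≤ lam0 j + k / n * R * T := by
    intro j t ht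
    have hmono := monotoneOn_Ico_of_deriv_nonneg (T := T)
      (f := fun t => k / n * R * t - lam j t)
      (fun t ht => ((hasDerivWithinAt_id t _).const_mul (k / n * R)).sub (hS.lam_deriv j t ht))
      (fun t ht => by
        have h1 : k / n * (ρ t - cb) ≤ k / n * R := by
          gcongr; linarith [hρR t ht]
        nlinarith [sq_nonneg (lam j t)])
    have h1 := hmono (Set.left_mem_Ico.2 hT) ht ht.1
    have h2 : k / n * R * t ≤ k / n * R * T := by gcongr; exact ht.2.le
    simp only [hS.lam_init, mul_zero] at h1
    linarith
  set M : ℝ := m + R + (∑ j, |lam0 j| + k / n * R * T) with hMdef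
  have hsum : ∀ j, lam0 j ≤ ∑ j, |lam0 j| := fun j => (le_abs_self _).trans
    (Finset.single_le_sum (f := fun j => |lam0 j|) (fun _ _ => abs_nonneg _) (Finset.mem_univ j))
  have hsum0 : 0 ≤ ∑ j, |lam0 j| := Finset.sum_nonneg fun _ _ => abs_nonneg _
  have hkR : 0 ≤ k / n * R * T := by positivity
  refine H.not_bounded hT (M := M) (fun j t ht => ?_) (fun t ht => ?_)
  · rw [abs_le]
    constructor
    · linarith [hlow j t ht]
    · linarith [hup j t ht, hsum j]
  · rw [abs_of_pos (hS.rho_pos hρ0 ht)]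
    linarith [hρR t ht]

/-- Not all components coincide at blow-up: otherwise `U'' = k / n (ρ - cb) U` with
`ρ U ≥ c / (T - t)`, so that `U' → ∞`, whereas `U' = lam U` is negative. -/
theorem exists_lam0_lt (H : IsMaximalREPSolution k cb lam0 ρ0 T lam ρ) (hT : 0 < T) (hn : 2 ≤ n)
    (hk : 0 < k) (hcb : 0 < cb) (hρ0 : 0 < ρ0) {i : Fin n} (hi : ∀ j, lam0 i ≤ lam0 j) :
    ∃ j, lam0 i < lam0 j := by
  have hS := H.isSolution
  by_contra! hcon
  have heq : ∀ j, lam0 j = lam0 i := fun j => le_antisymm (hcon j) (hi j)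
  have hbot := H.tendsto_atBot hT hk hcb hρ0 hi
  obtain ⟨M, hM0, hM⟩ := hS.U_decay hT hk hcb hρ0 hbot
  have hU : ∀ j, ∀ t ∈ Set.Ico 0 T, expPrimitive (lam j) t = expPrimitive (lam i) t := by
    intro j t ht
    rw [hS.U_eq i j ht, heq j]; simp
  have hU0 := hS.tendsto_U_zero hT hk hcb hρ0 hbot
  have hn0 : (0 : ℝ) < n := by exact_mod_cast (by omega : 0 < n)
  have htop : Tendsto (fun t => lam i t * expPrimitive (lam i) t) (𝓝[<] T) atTop := by
    refine tendsto_atTop_of_deriv_ge_inv (c := k / n * (ρ0 / M)) (K := k / n * cb) hT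
      (by positivity) (fun t ht => (hS.hasDerivWithinAt_lam_mul_U i
        (Set.Ioo_subset_Ico_self ht)).hasDerivAt (Ico_mem_nhds ht.1 ht.2)) ?_
    filter_upwards [hM, hU0.eventually_le_const one_pos, Ico_mem_nhdsLT hT] with t h1 h2 ht
    have hTt : 0 < T - t := sub_pos.2 ht.2
    have hu := expPrimitive_pos (lam i) t
    have hρ := hS.rho_pos hρ0 ht
    have h3 : ρ0 / M / (T - t) ≤ ρ t * expPrimitive (lam i) t := by
      rw [div_div, div_le_iff₀ (by positivity), ← hS.rho_mul_prod ht,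
        Finset.prod_congr rfl fun j _ => hU j t ht]
      simp only [Finset.prod_const, Finset.card_univ, Fintype.card_fin]
      rw [mul_assoc]
      gcongr
      calc expPrimitive (lam i) t ^ n ≤ expPrimitive (lam i) t ^ 2 :=
            pow_le_pow_of_le_one hu.le h2 hn
        _ = expPrimitive (lam i) t * expPrimitive (lam i) t := sq _
        _ ≤ _ := by gcongr; exact h1.1
    have h4 : k / n * (ρ0 / M / (T - t)) ≤ k / n * (ρ t * expPrimitive (lam i) t) := by gcongr
    have h5 : k / n * cb * expPrimitive (lam i) t ≤ k / n * cb * 1 := by gcongr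
    have h6 : k / n * (ρ0 / M) / (T - t) = k / n * (ρ0 / M / (T - t)) := by ring
    rw [h6]
    linarith
  obtain ⟨t, h1, h2⟩ := ((htop.eventually_gt_atTop 0).and (hbot.eventually_lt_atBot 0)).exists
  exact absurd (mul_neg_of_neg_of_pos h2 (expPrimitive_pos (lam i) t)) (not_lt.2 h1.le)

/-- The components above the lowest one tend to `+∞`. A finite limit would make `ρ` at least of
order `1 / (T - t)` and hence let the component diverge logarithmically. -/
theorem tendsto_atTop (H : IsMaximalREPSolution k cb lam0 ρ0 T lam ρ) (hT : 0 < T)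
    (hk : 0 < k) (hcb : 0 < cb) (hρ0 : 0 < ρ0) {i : Fin n} (hi : ∀ j, lam0 i ≤ lam0 j)
    {l : Fin n} (hl : lam0 i < lam0 l) : Tendsto (lam l) (𝓝[<] T) atTop := by
  have hS := H.isSolution
  have hn : 0 < n := i.pos
  have hn0 : (0 : ℝ) < n := by exact_mod_cast hn
  have hbot := H.tendsto_atBot hT hk hcb hρ0 hi
  rcases hS.trichotomy hT hn hk hcb hρ0 l with h | h | ⟨L, hL⟩
  · exact absurd (hS.eq_of_tendsto_atBot hT hk hcb hρ0 hbot h) hl.ne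
  · exact h
  · obtain ⟨M, hM0, hM⟩ := hS.U_decay hT hk hcb hρ0 hbot
    set d : ℝ := lam0 l - lam0 i with hd
    have hd0 : 0 < d := sub_pos.2 hl
    -- `U l` is bounded, and so are all `U j`, which are bounded by multiples of `U l`
    obtain ⟨a, ha0, haT, ha⟩ := eventually_Ioo_of_nhdsLT hT
      (hL.eventually_le_const (show L < |L| + 1 by linarith [le_abs_self L]))
    have hmono := monotoneOn_of_hasDerivAt_nonneg (convex_Ico a T)
      (f := fun t => -(expPrimitive (lam l) t * Real.exp (-((|L| + 1) * t))))
      (f' := fun t => (|L| + 1 - lam l t) *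
        (expPrimitive (lam l) t * Real.exp (-((|L| + 1) * t))))
      (fun t ht => by
        have ht0 : 0 < t := ha0.trans_le ht.1
        refine (((hS.hasDerivWithinAt_U l ⟨ht0.le, ht.2⟩).hasDerivAt
          (Ico_mem_nhds ht0 ht.2)).mul
          (((hasDerivAt_id t).const_mul (|L| + 1)).neg.exp)).neg.congr_deriv ?_
        simp only [Pi.neg_apply, id]
        ring)
      (fun t ht => mul_nonneg (by linarith [ha t ht])
        (mul_pos (expPrimitive_pos _ _) (Real.exp_pos _)).le)
    set B₀ : ℝ := expPrimitive (lam l) a * Real.exp (-((|L| + 1) * a)) *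
      Real.exp ((|L| + 1) * T) with hB₀
    have hB₀pos : 0 < B₀ := mul_pos (mul_pos (expPrimitive_pos _ _) (Real.exp_pos _))
      (Real.exp_pos _)
    have hUl : ∀ t ∈ Set.Ico a T, expPrimitive (lam l) t ≤ B₀ := by
      intro t ht
      have h1 := hmono (Set.left_mem_Ico.2 haT) ht ht.1
      simp only at h1
      calc expPrimitive (lam l) t = expPrimitive (lam l) t * Real.exp (-((|L| + 1) * t)) *
            Real.exp ((|L| + 1) * t) := by rw [mul_assoc, ← Real.exp_add]; simp
        _ ≤ _ := by
          rw [hB₀]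
          refine mul_le_mul (neg_le_neg_iff.1 h1) (Real.exp_le_exp.2 ?_) (Real.exp_pos _).le
            (mul_pos (expPrimitive_pos _ _) (Real.exp_pos _)).le
          gcongr
          exact ht.2.le
    set s : ℝ := ∑ j, |lam0 j - lam0 i| with hs
    have hs0 : 0 ≤ s := Finset.sum_nonneg fun _ _ => abs_nonneg _
    have hUj : ∀ t ∈ Set.Ico a T, ∀ j, expPrimitive (lam j) t ≤ (1 + s / d) * B₀ := by
      intro t ht j
      have ht' : t ∈ Set.Ico 0 T := ⟨ha0.le.trans ht.1, ht.2⟩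
      have h1 : lam0 j - lam0 i ≤ s := (le_abs_self _).trans (Finset.single_le_sum
        (f := fun j => |lam0 j - lam0 i|) (fun _ _ => abs_nonneg _) (Finset.mem_univ j))
      have hSn : 0 ≤ ∫ s in (0 : ℝ)..t, (expPrimitive (lam i) s ^ 2)⁻¹ :=
        IsREPSolution.integral_inv_sq_nonneg i ht'.1
      have hu := expPrimitive_pos (lam i) t
      refine le_trans ?_ (mul_le_mul_of_nonneg_left (hUl t ht) (by positivity))
      rw [hS.U_eq i j ht', hS.U_eq i l ht', ← hd]
      set I := ∫ s in (0 : ℝ)..t, (expPrimitive (lam i) s ^ 2)⁻¹ with hI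
      have h2 : (1 + s / d) * (expPrimitive (lam i) t * (1 + d * I)) =
          expPrimitive (lam i) t * (1 + s / d + d * I + s * I) := by field_simp; ring
      rw [h2]
      gcongr
      have h3 : (lam0 j - lam0 i) * I ≤ s * I := by gcongr
      have h4 : 0 ≤ s / d := by positivity
      have h5 : 0 ≤ d * I := by positivity
      linarith
    obtain ⟨c, hc0, hc⟩ := hS.inv_le_rho hT hρ0 hM0 (B := (1 + s / d) * B₀) (by positivity)
      (hM.mono fun t h => h.1)
      (by filter_upwards [Ico_mem_nhdsLT haT] with t ht j _ using hUj t ht j)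
    refine tendsto_atTop_of_deriv_ge_inv (c := k / n * c) (K := L ^ 2 + 1 + k / n * cb) hT
      (by positivity) (fun t ht => (hS.lam_deriv l t
        (Set.Ioo_subset_Ico_self ht)).hasDerivAt (Ico_mem_nhds ht.1 ht.2)) ?_
    filter_upwards [hc, (hL.pow 2).eventually_le_const (show L ^ 2 < L ^ 2 + 1 by linarith)]
      with t h1 h2
    have h3 : k / n * (c / (T - t)) ≤ k / n * ρ t := by gcongr
    have h4 : k / n * c / (T - t) = k / n * (c / (T - t)) := by ring
    rw [h4]
    linarith

end IsMaximalREPSolution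

/-! ### Passage to the rescaled system -/

/-- The quotient `v / U` of two solutions of the linear equation `U'' = k / n (ρ - cb) U`, where
`U = exp ∫ f` and `v(0) = 0`, `v'(0) = 1`, obtained by reduction of order. -/
noncomputable def solutionQuotient (f : ℝ → ℝ) (t : ℝ) : ℝ :=
  ∫ s in (0 : ℝ)..t, (expPrimitive f s ^ 2)⁻¹

/-- The product `U v` of the two solutions of the linear equation described at
`solutionQuotient`. -/
noncomputable def solutionProduct (f : ℝ → ℝ) (t : ℝ) : ℝ :=
  expPrimitive f t ^ 2 * solutionQuotient f t

namespace IsREPSolution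

variable {n : ℕ} {k cb : ℝ} {lam0 : Fin n → ℝ} {ρ0 T : ℝ} {lam : Fin n → ℝ → ℝ} {ρ : ℝ → ℝ}

theorem hasDerivAt_lam (H : IsREPSolution k cb lam0 ρ0 T lam ρ) (i : Fin n) {t : ℝ}
    (ht : t ∈ Set.Ioo 0 T) : HasDerivAt (lam i) (-(lam i t) ^ 2 + k / n * (ρ t - cb)) t :=
  (H.lam_deriv i t (Set.Ioo_subset_Ico_self ht)).hasDerivAt (Ico_mem_nhds ht.1 ht.2)

theorem hasDerivAt_quotient (H : IsREPSolution k cb lam0 ρ0 T lam ρ) (i : Fin n) {t : ℝ}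
    (ht : t ∈ Set.Ioo 0 T) :
    HasDerivAt (solutionQuotient (lam i)) (expPrimitive (lam i) t ^ 2)⁻¹ t :=
  (hasDerivWithinAt_primitive (H.inv_sq_continuousOn i)
    (Set.Ioo_subset_Ico_self ht)).hasDerivAt (Ico_mem_nhds ht.1 ht.2)

theorem quotient_pos (H : IsREPSolution k cb lam0 ρ0 T lam ρ) (i : Fin n) {t : ℝ}
    (ht : t ∈ Set.Ioo 0 T) : 0 < solutionQuotient (lam i) t :=
  intervalIntegral.intervalIntegral_pos_of_pos_on
    (intervalIntegrable_of_continuousOn_Ico (H.inv_sq_continuousOn i)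
      (Set.Ioo_subset_Ico_self ht))
    (fun _ _ => inv_pos.2 (pow_pos (expPrimitive_pos _ _) 2)) ht.1

theorem product_pos (H : IsREPSolution k cb lam0 ρ0 T lam ρ) (i : Fin n) {t : ℝ}
    (ht : t ∈ Set.Ioo 0 T) : 0 < solutionProduct (lam i) t :=
  mul_pos (pow_pos (expPrimitive_pos _ _) 2) (H.quotient_pos i ht)

theorem hasDerivAt_product (H : IsREPSolution k cb lam0 ρ0 T lam ρ) (i : Fin n) {t : ℝ}
    (ht : t ∈ Set.Ioo 0 T) :
    HasDerivAt (solutionProduct (lam i)) (1 + 2 * lam i t * solutionProduct (lam i) t) t := by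
  have hU := (H.hasDerivWithinAt_U i (Set.Ioo_subset_Ico_self ht)).hasDerivAt
    (Ico_mem_nhds ht.1 ht.2)
  refine ((hU.pow 2).mul (H.hasDerivAt_quotient i ht)).congr_deriv ?_
  have := expPrimitive_pos (lam i) t
  simp only [solutionProduct, Pi.pow_apply]
  field_simp
  ring

theorem product_mul_lam (H : IsREPSolution k cb lam0 ρ0 T lam ρ) {i j : Fin n}
    (hij : lam0 i ≤ lam0 j) {t : ℝ} (ht : t ∈ Set.Ioo 0 T) :
    solutionProduct (lam i) t * lam j t = solutionProduct (lam i) t * lam i t +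
      (lam0 j - lam0 i) * solutionQuotient (lam i) t /
        (1 + (lam0 j - lam0 i) * solutionQuotient (lam i) t) := by
  have hW := H.wronskian j i (Set.Ioo_subset_Ico_self ht)
  have hU := H.U_eq i j (Set.Ioo_subset_Ico_self ht)
  rw [← solutionQuotient] at hU
  rw [hU] at hW
  have hS := H.quotient_pos i ht
  have hd : 0 ≤ lam0 j - lam0 i := sub_nonneg.2 hij
  have h1 : 0 < 1 + (lam0 j - lam0 i) * solutionQuotient (lam i) t := by positivity
  rw [← sub_eq_iff_eq_add', eq_div_iff h1.ne', solutionProduct]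
  linear_combination solutionQuotient (lam i) t * hW

/-- The sum of all components in terms of the lowest one. In the variable `x` the last sum is the
error `η` of `RescaledSystem`. -/
theorem product_mul_sum (H : IsREPSolution k cb lam0 ρ0 T lam ρ) {i : Fin n}
    (hi : ∀ j, lam0 i ≤ lam0 j) {J : ℕ}
    (hJ : J = (Finset.univ.filter fun j => lam0 j = lam0 i).card) {t : ℝ}
    (ht : t ∈ Set.Ioo 0 T) :
    solutionProduct (lam i) t * ∑ j, lam j t = n * (solutionProduct (lam i) t * lam i t) +
      (n - J) - ∑ j ∈ Finset.univ.filter fun j => ¬ lam0 j = lam0 i,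
        1 / (1 + (lam0 j - lam0 i) * solutionQuotient (lam i) t) := by
  set S := solutionQuotient (lam i) t with hS
  have hS0 : 0 < S := H.quotient_pos i ht
  have hcard : (n : ℝ) - J = ((Finset.univ.filter fun j => ¬ lam0 j = lam0 i).card : ℝ) := by
    have := Finset.card_filter_add_card_filter_not (s := (Finset.univ : Finset (Fin n)))
      (fun j => lam0 j = lam0 i)
    rw [← hJ, Finset.card_univ, Fintype.card_fin] at this
    rw [sub_eq_iff_eq_add']
    exact_mod_cast this.symm
  have hsum : ∑ j, (lam0 j - lam0 i) * S / (1 + (lam0 j - lam0 i) * S) =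
      ∑ j ∈ Finset.univ.filter fun j => ¬ lam0 j = lam0 i,
        (1 - 1 / (1 + (lam0 j - lam0 i) * S)) := by
    rw [Finset.sum_filter]
    refine Finset.sum_congr rfl fun j _ => ?_
    by_cases h : lam0 j = lam0 i
    · simp [h]
    · have hd : 0 ≤ lam0 j - lam0 i := sub_nonneg.2 (hi j)
      have h1 : 0 < 1 + (lam0 j - lam0 i) * S := by positivity
      rw [if_pos h]
      field_simp
      ring
  rw [Finset.mul_sum, Finset.sum_congr rfl fun j _ => H.product_mul_lam (hi j) ht,
    Finset.sum_add_distrib, hsum, Finset.sum_sub_distrib, hcard]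
  simp
  ring

end IsREPSolution

namespace IsMaximalREPSolution

variable {n : ℕ} {k cb : ℝ} {lam0 : Fin n → ℝ} {ρ0 T : ℝ} {lam : Fin n → ℝ → ℝ} {ρ : ℝ → ℝ}

theorem tendsto_log_quotient (H : IsMaximalREPSolution k cb lam0 ρ0 T lam ρ) (hT : 0 < T)
    (hk : 0 < k) (hcb : 0 < cb) (hρ0 : 0 < ρ0) {i : Fin n} (hi : ∀ j, lam0 i ≤ lam0 j) :
    Tendsto (fun t => Real.log (solutionQuotient (lam i) t)) (𝓝[<] T) atTop := by
  have hS := H.isSolution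
  obtain ⟨M, hM0, hM⟩ := hS.U_decay hT hk hcb hρ0 (H.tendsto_atBot hT hk hcb hρ0 hi)
  refine Real.tendsto_log_atTop.comp (tendsto_atTop_of_deriv_ge_inv (c := 1 / (M ^ 2 * T))
    (K := 0) hT (by positivity) (fun t ht => hS.hasDerivAt_quotient i ht) ?_)
  filter_upwards [hM, Ioo_mem_nhdsLT hT] with t h1 ht
  have hTt : 0 < T - t := sub_pos.2 ht.2
  have hu := expPrimitive_pos (lam i) t
  rw [sub_zero, div_div, one_div]
  apply inv_anti₀ (by positivity)
  calc expPrimitive (lam i) t ^ 2 ≤ (M * (T - t)) ^ 2 := by gcongr; exact h1.1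
    _ = M ^ 2 * (T - t) * (T - t) := by ring
    _ ≤ M ^ 2 * T * (T - t) := by gcongr; linarith [ht.1]

/-- The upper bound expresses that `v` is eventually nondecreasing. -/
theorem eventually_mem_unit (H : IsMaximalREPSolution k cb lam0 ρ0 T lam ρ) (hT : 0 < T)
    (hk : 0 < k) (hcb : 0 < cb) (hρ0 : 0 < ρ0) {i l : Fin n} (hi : ∀ j, lam0 i ≤ lam0 j)
    (hl : lam0 i < lam0 l) : ∀ᶠ t in 𝓝[<] T,
      0 ≤ -lam i t * solutionProduct (lam i) t ∧ -lam i t * solutionProduct (lam i) t ≤ 1 := by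
  have hS := H.isSolution
  filter_upwards [(H.tendsto_atBot hT hk hcb hρ0 hi).eventually_le_atBot 0,
    (H.tendsto_atTop hT hk hcb hρ0 hi hl).eventually_ge_atTop 0, Ioo_mem_nhdsLT hT]
    with t h1 h2 ht
  have hw := hS.product_pos i ht
  refine ⟨mul_nonneg (by linarith) hw.le, ?_⟩
  have h3 := hS.product_mul_lam hl.le ht
  have h4 := mul_nonneg hw.le h2
  have hd : 0 ≤ lam0 l - lam0 i := sub_nonneg.2 hl.le
  have hq := hS.quotient_pos i ht
  have h5 : (lam0 l - lam0 i) * solutionQuotient (lam i) t /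
      (1 + (lam0 l - lam0 i) * solutionQuotient (lam i) t) ≤ 1 :=
    div_le_one_of_le₀ (by linarith) (by positivity)
  linarith

/-- The product `w` is Lipschitz near `T`, hence convergent, and its limit is `0` since `∫ 1 / w`
diverges. -/
theorem tendsto_product (H : IsMaximalREPSolution k cb lam0 ρ0 T lam ρ) (hT : 0 < T)
    (hk : 0 < k) (hcb : 0 < cb) (hρ0 : 0 < ρ0) {i l : Fin n} (hi : ∀ j, lam0 i ≤ lam0 j)
    (hl : lam0 i < lam0 l) : Tendsto (solutionProduct (lam i)) (𝓝[<] T) (𝓝 0) := by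
  have hS := H.isSolution
  obtain ⟨a, ha0, haT, ha⟩ := eventually_Ioo_of_nhdsLT hT
    (H.eventually_mem_unit hT hk hcb hρ0 hi hl)
  obtain ⟨L, hL⟩ : ∃ L, Tendsto (solutionProduct (lam i)) (𝓝[<] T) (𝓝 L) := by
    have hup : MonotoneOn (fun t => 1 * t - solutionProduct (lam i) t) (Set.Ico a T) :=
      monotoneOn_of_hasDerivAt_nonneg (convex_Ico a T)
        (f' := fun t => 1 * 1 - (1 + 2 * lam i t * solutionProduct (lam i) t))
        (fun t ht => ((hasDerivAt_id t).const_mul 1).sub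
          (hS.hasDerivAt_product i ⟨ha0.trans_le ht.1, ht.2⟩))
        (fun t ht => by linarith [(ha t ht).1])
    refine exists_tendsto_of_neg_le_deriv (K := 1)
      (M := T - a + solutionProduct (lam i) a) haT
      (fun t ht => hS.hasDerivAt_product i ⟨ha0.trans ht.1, ht.2⟩)
      (fun t ht => by linarith [(ha t (Set.Ioo_subset_Ico_self ht)).2]) (fun t ht => ?_)
    have := hup (Set.left_mem_Ico.2 haT) (Set.Ioo_subset_Ico_self ht) ht.1.le
    simp only at this
    linarith [ht.2]
  have hL0 : 0 ≤ L := ge_of_tendsto hL (by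
    filter_upwards [Ioo_mem_nhdsLT hT] with t ht using (hS.product_pos i ht).le)
  rcases hL0.eq_or_lt with rfl | hL0
  · exact hL
  exfalso
  have hlog := H.tendsto_log_quotient hT hk hcb hρ0 hi
  obtain ⟨b, hb0, hbT, hb⟩ := eventually_Ioo_of_nhdsLT hT
    ((hL.eventually_const_le (show L / 2 < L by linarith)).and (hlog.eventually_ge_atTop 0))
  obtain ⟨l', hl'⟩ := exists_tendsto_of_neg_le_deriv (K := 2 / L) (M := 0) hbT
    (f := fun t => -Real.log (solutionQuotient (lam i) t))
    (f' := fun t => -((expPrimitive (lam i) t ^ 2)⁻¹ / solutionQuotient (lam i) t))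
    (fun t ht => ((hS.hasDerivAt_quotient i ⟨hb0.trans ht.1, ht.2⟩).log
      (hS.quotient_pos i ⟨hb0.trans ht.1, ht.2⟩).ne').neg)
    (fun t ht => by
      have h1 := (hb t (Set.Ioo_subset_Ico_self ht)).1
      have h2 : (expPrimitive (lam i) t ^ 2)⁻¹ / solutionQuotient (lam i) t =
          (solutionProduct (lam i) t)⁻¹ := by
        rw [solutionProduct, mul_inv, div_eq_mul_inv]
      rw [h2, neg_le_neg_iff]
      have := inv_anti₀ (by linarith : 0 < L / 2) h1
      rwa [inv_div] at this)
    (fun t ht => by linarith [(hb t (Set.Ioo_subset_Ico_self ht)).2])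
  exact not_tendsto_nhds_of_tendsto_atTop hlog (-l') (by simpa using hl'.neg)

/-- In the variable `x = log (v / U)` the solution becomes a `RescaledSystem`. -/
theorem exists_rescaledSystem (H : IsMaximalREPSolution k cb lam0 ρ0 T lam ρ) (hT : 0 < T)
    (hk : 0 < k) (hcb : 0 < cb) (hρ0 : 0 < ρ0) {i l : Fin n} (hi : ∀ j, lam0 i ≤ lam0 j)
    (hl : lam0 i < lam0 l) {J : ℕ}
    (hJ : J = (Finset.univ.filter fun j => lam0 j = lam0 i).card) :
    ∃ (τ η : ℝ → ℝ) (C : ℝ), RescaledSystem n J (k / n * cb) C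
      (fun x => -lam i (τ x) * solutionProduct (lam i) (τ x))
      (fun x => k / n * ρ (τ x) * solutionProduct (lam i) (τ x) ^ 2)
      (fun x => solutionProduct (lam i) (τ x)) τ η ∧
      ∀ᶠ t in 𝓝[<] T, τ (Real.log (solutionQuotient (lam i) t)) = t := by
  have hS := H.isSolution
  have hn0 : (0 : ℝ) < n := Nat.cast_pos.2 i.pos
  obtain ⟨τ, hτd, hτi, hτT, hτl⟩ := exists_inverse_clock hT
    (φ := fun t => Real.log (solutionQuotient (lam i) t)) (w := solutionProduct (lam i))
    (fun t ht => by
      refine ((hS.hasDerivAt_quotient i ht).log (hS.quotient_pos i ht).ne').congr_deriv ?_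
      rw [solutionProduct, mul_inv, div_eq_mul_inv])
    (fun t ht => hS.product_pos i ht) (H.tendsto_log_quotient hT hk hcb hρ0 hi)
  have hmem : ∀ᶠ x in atTop, τ x ∈ Set.Ioo 0 T := hτT.eventually (Ioo_mem_nhdsLT hT)
  have hexp : ∀ᶠ x in atTop, solutionQuotient (lam i) (τ x) = Real.exp x := by
    filter_upwards [hτi, hmem] with x h1 h2
    rw [← h1, Real.exp_log (hS.quotient_pos i h2), h1]
  refine ⟨τ, fun x => ∑ j ∈ Finset.univ.filter fun j => ¬ lam0 j = lam0 i,
      1 / (1 + (lam0 j - lam0 i) * Real.exp x),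
    ∑ j ∈ Finset.univ.filter fun j => ¬ lam0 j = lam0 i, 1 / (lam0 j - lam0 i), ?_, hτl⟩
  constructor
  · exact hτT.eventually (H.eventually_mem_unit hT hk hcb hρ0 hi hl)
  · filter_upwards [hmem] with x hx
    have h1 := hS.rho_pos hρ0 (Set.Ioo_subset_Ico_self hx)
    have h2 := hS.product_pos i hx
    positivity
  · filter_upwards [hmem] with x hx using hS.product_pos i hx
  · refine Eventually.of_forall fun x => ⟨Finset.sum_nonneg fun j _ => ?_, ?_⟩
    · have hd : 0 ≤ lam0 j - lam0 i := sub_nonneg.2 (hi j)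
      positivity
    · rw [Finset.sum_mul]
      refine Finset.sum_le_sum fun j hj => ?_
      have hd : 0 < lam0 j - lam0 i :=
        sub_pos.2 (lt_of_le_of_ne (hi j) (Ne.symm (Finset.mem_filter.1 hj).2))
      rw [Real.exp_neg, ← one_div, one_div_mul_one_div]
      exact one_div_le_one_div_of_le (by positivity) (by linarith)
  · filter_upwards [hmem, hτd] with x hx hd
    refine (((hS.hasDerivAt_lam i hx).neg.mul (hS.hasDerivAt_product i hx)).comp x
      hd).congr_deriv ?_
    simp only [Pi.neg_apply]
    ring
  · filter_upwards [hmem, hτd, hexp] with x hx hd he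
    have hρ : HasDerivAt ρ (-(ρ (τ x)) * ∑ j, lam j (τ x)) (τ x) :=
      (hS.rho_deriv _ (Set.Ioo_subset_Ico_self hx)).hasDerivAt (Ico_mem_nhds hx.1 hx.2)
    refine (((hρ.const_mul (k / n)).mul ((hS.hasDerivAt_product i hx).pow 2)).comp x
      hd).congr_deriv ?_
    have hsum := hS.product_mul_sum hi hJ hx
    rw [he] at hsum
    simp only [Pi.pow_apply]
    linear_combination (-(k / n * ρ (τ x) * solutionProduct (lam i) (τ x) ^ 2)) * hsum
  · filter_upwards [hmem, hτd] with x hx hd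
    refine ((hS.hasDerivAt_product i hx).comp x hd).congr_deriv ?_
    ring
  · exact hτd
  · exact ⟨T, hτT.mono_right nhdsWithin_le_nhds⟩
  · exact (H.tendsto_product hT hk hcb hρ0 hi hl).comp hτT

end IsMaximalREPSolution

/-- For monotone data the indices with the lowest value form the initial segment of length `J`. -/
theorem val_lt_card_filter_iff {n : ℕ} {lam0 : Fin n → ℝ} (hlam0 : Monotone lam0) {i : Fin n}
    (hi : i.val = 0) (j : Fin n) :
    j.val < (Finset.univ.filter fun j => lam0 j = lam0 i).card ↔ lam0 j = lam0 i := by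
  have hle : ∀ j, lam0 i ≤ lam0 j := fun j => hlam0 (Fin.le_def.2 (by omega))
  constructor
  · intro h
    by_contra hne
    have hsub : (Finset.univ.filter fun j => lam0 j = lam0 i) ⊆ Finset.Iio j := by
      intro m hm
      rw [Finset.mem_Iio]
      by_contra! hcon
      exact hne (le_antisymm ((hlam0 hcon).trans (Finset.mem_filter.1 hm).2.le) (hle j))
    have := Finset.card_le_card hsub
    rw [Fin.card_Iio] at this
    omega
  · intro h
    have hsub : Finset.Iic j ⊆ (Finset.univ.filter fun j => lam0 j = lam0 i) := by
      intro m hm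
      exact Finset.mem_filter.2 ⟨Finset.mem_univ _,
        le_antisymm ((hlam0 (Finset.mem_Iic.1 hm)).trans h.le) (hle m)⟩
    have := Finset.card_le_card hsub
    rw [Fin.card_Iic] at this
    omega

/-! ### Blow-up of maximal solutions -/

theorem theorem1p1 (n : ℕ) (hn : 2 ≤ n) (k cb : ℝ) (hk : 0 < k) (hcb : 0 < cb)
    (lam0 : Fin n → ℝ) (hlam0 : Monotone lam0) (ρ0 : ℝ) (hρ0 : 0 < ρ0)
    (tB : ℝ) (htB : 0 < tB) (lam : Fin n → ℝ → ℝ) (ρ : ℝ → ℝ)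
    (hmax : IsMaximalREPSolution k cb lam0 ρ0 tB lam ρ)
    (J : ℕ) (hJ : J = multiplicityFirst (by omega : 0 < n) lam0)
    (ω : ℝ) (hω : ω = Real.sqrt (k * cb / n))
    (first last : Fin n) (hfirst : first.val = 0) (hlast : last.val = n - 1) :
    (1 ≤ J ∧ (J : ℝ) ≤ n / 2) ∧
    1 / ω * Real.arctan (lam0 first / ω) + Real.pi / (2 * ω) ≤ tB ∧
    (∀ i : Fin n, i.val < J → Tendsto (lam i) (𝓝[<] tB) atBot) ∧
    (∀ i : Fin n, J ≤ i.val → Tendsto (lam i) (𝓝[<] tB) atTop) ∧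
    Tendsto ρ (𝓝[<] tB) atTop ∧
    ∃ p q : ℝ, 0 ≤ q ∧ q ≤ p ∧
      Tendsto (fun t => lam first t * Real.exp (∫ s in (0 : ℝ)..t, (lam first s + lam last s)))
        (𝓝[<] tB) (𝓝 (-p)) ∧
      Tendsto (fun t => lam last t * Real.exp (∫ s in (0 : ℝ)..t, (lam first s + lam last s)))
        (𝓝[<] tB) (𝓝 q) := by
  have hS := hmax.isSolution
  have hn0 : (0 : ℝ) < n := Nat.cast_pos.2 (by omega)
  have hi : ∀ j, lam0 first ≤ lam0 j := fun j => hlam0 (Fin.le_def.2 (by omega))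
  have hJ' : J = (Finset.univ.filter fun j => lam0 j = lam0 first).card := by
    rw [hJ, multiplicityFirst, show first = ⟨0, by omega⟩ from Fin.ext hfirst]
  have hiff : ∀ j : Fin n, j.val < J ↔ lam0 j = lam0 first := fun j => by
    rw [hJ']; exact val_lt_card_filter_iff hlam0 hfirst j
  obtain ⟨l, hl⟩ := hmax.exists_lam0_lt htB hn hk hcb hρ0 hi
  have hll : lam0 first < lam0 last := hl.trans_le (hlam0 (Fin.le_def.2 (by omega)))
  have hJ1 : 1 ≤ J := by have := (hiff first).2 rfl; omega
  have hJn : J < n := by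
    have := mt (hiff last).1 hll.ne'
    omega
  have hbot := hmax.tendsto_atBot htB hk hcb hρ0 hi
  obtain ⟨τ, η, C, hR, hτ⟩ := hmax.exists_rescaledSystem htB hk hcb hρ0 hi hll hJ'
  obtain ⟨h2J, ⟨p, hp, hp1, hP⟩, hρ⟩ := hR.asymptotics hJ1 hJn
  have hclock := hmax.tendsto_log_quotient htB hk hcb hρ0 hi
  have hPt : Tendsto (fun t => -lam first t * solutionProduct (lam first) t) (𝓝[<] tB) (𝓝 p) :=
    (hP.comp hclock).congr' (hτ.mono fun t ht => by simp only [Function.comp, ht])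
  have hρt : Tendsto ρ (𝓝[<] tB) atTop := by
    have h1 := (hρ.comp hclock).const_mul_atTop (show 0 < (k / n)⁻¹ by positivity)
    refine h1.congr' ?_
    filter_upwards [hτ, Ioo_mem_nhdsLT htB] with t ht htm
    have hw := hS.product_pos first htm
    simp only [Function.comp, ht]
    field_simp
  set D : ℝ := lam0 last - lam0 first with hD
  have hD0 : 0 < D := sub_pos.2 hll
  have hexp : ∀ t ∈ Set.Ico 0 tB, Real.exp (∫ s in (0 : ℝ)..t, (lam first s + lam last s)) =
      expPrimitive (lam first) t * expPrimitive (lam last) t := by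
    intro t ht
    rw [intervalIntegral.integral_add
      (intervalIntegrable_of_continuousOn_Ico (hS.continuousOn_lam first) ht)
      (intervalIntegrable_of_continuousOn_Ico (hS.continuousOn_lam last) ht), Real.exp_add]
    rfl
  have hfirstlim : Tendsto (fun t => lam first t *
      Real.exp (∫ s in (0 : ℝ)..t, (lam first s + lam last s))) (𝓝[<] tB) (𝓝 (-(D * p))) := by
    obtain ⟨M, hM0, hM⟩ := hS.U_decay htB hk hcb hρ0 hbot
    have hsmall : Tendsto (fun t => lam first t * expPrimitive (lam first) t *
        expPrimitive (lam first) t) (𝓝[<] tB) (𝓝 0) := by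
      refine squeeze_zero_norm' (a := fun t => M * expPrimitive (lam first) t) ?_
        (by simpa using (hS.tendsto_U_zero htB hk hcb hρ0 hbot).const_mul M)
      filter_upwards [hM] with t h1
      have hu := expPrimitive_pos (lam first) t
      rw [norm_mul, Real.norm_eq_abs, Real.norm_eq_abs, abs_of_pos hu]
      gcongr
      exact h1.2
    have h := hsmall.sub (hPt.const_mul D)
    rw [zero_sub] at h
    refine h.congr' ?_
    filter_upwards [Ico_mem_nhdsLT htB] with t ht
    rw [hexp t ht, hS.U_eq first last ht, ← solutionQuotient, ← hD, solutionProduct]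
    ring
  refine ⟨⟨hJ1, ?_⟩, hS.blowup_time_le htB (by omega) hk hcb hρ0 hbot hω, fun i hiJ => ?_,
    fun i hiJ => ?_, hρt, D * p, D - D * p, ?_, ?_, hfirstlim, ?_⟩
  · have : 2 * (J : ℝ) ≤ n := by exact_mod_cast h2J
    linarith
  · refine hmax.tendsto_atBot htB hk hcb hρ0 fun j => ?_
    rw [(hiff i).1 hiJ]
    exact hi j
  · refine hmax.tendsto_atTop htB hk hcb hρ0 hi (lt_of_le_of_ne (hi i) fun h => ?_)
    have := (hiff i).2 h.symm
    omega
  · nlinarith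
  · nlinarith
  · have h := hfirstlim.const_add D
    rw [← sub_eq_add_neg] at h
    refine h.congr' ?_
    filter_upwards [Ico_mem_nhdsLT htB] with t ht
    rw [hexp t ht, hD, ← hS.wronskian last first ht]
    ring
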